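/- Let $0<p<1$. Consider the discrete time TASEP with parallel update on $\mathbb{Z}$, with finitely or infinitely many particles labelled $1,2,\ldots$, starting at time $0$ from the fixed positions $y_1>y_2>\cdots$: at each time step every particle, independently of everything else, jumps one site to the right with probability $p$ provided that this site is empty at the beginning of the step. Let $x_j(t)$ be the position of particle $j$ at time $t\in\{0,1,2,\ldots\}$. Write $(n,t)\prec(n',t')$ if $n\le n'$, $t\ge t'$ and $(n,t)\neq(n',t')$, and let $(n_1,t_1)\prec(n_2,t_2)\prec\cdots\prec(n_m,t_m)$ be a space-like path ($n_i$ particle labels, $t_i$ times). Let $\Gamma_{0,-1}$ be any anticlockwise simple loop with $0$ and $-1$ inside and $-1/p$ outside. For $n,k\ge1$, $t\ge0$, $x\in\mathbb{Z}$ put $$\Psi^{n,t}_{n-k}(x)=\frac{1}{2\pi i}\oint_{\Gamma_{0,-1}}dw\,\frac{(1+pw)^t}{(1+w)^{x-y_k+1}}\Big(\frac{w}{(1+w)(1+pw)}\Big)^{n-k},$$ $$\phi^{*((n,t),(n',t'))}(x,x')=\mathbf 1_{[(n,t)\prec(n',t')]}\,\frac{1}{2\pi i}\oint_{\Gamma_{0,-1}}dw\,\frac{(1+pw)^{t-t'}}{(1+w)^{x-x'+1}}\Big(\frac{w}{(1+w)(1+pw)}\Big)^{n-n'}.$$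 For $(n,t)=(n_i,t_i)$ consider the two conditions on functions $\Phi^{n,t}_{n-k}:\mathbb{Z}\to\mathbb{C}$, $k=1,\ldots,n$: $$\sum_{x\in\mathbb{Z}}\Psi^{n,t}_{n-l}(x)\Phi^{n,t}_{n-k}(x)=\delta_{k,l}\ \ (1\le k,l\le n,\ \text{absolutely convergent sums}),\qquad \mathrm{span}\{\Phi^{n,t}_{n-k}\}_{k=1}^n=\mathrm{span}\{1,x,\ldots,x^{n-1}\}.$$ (a) There is at most one such family, and there is one if $p<\tfrac12$ or $n\le t+1$. (b) If for each $i$ functions $\Phi^{n_i,t_i}_{n_i-k}$ satisfying the two conditions are given, then for all $a_1,\ldots,a_m\in\mathbb{Z}$ $$\mathbb{P}\Big(\bigcap_{k=1}^m\{x_{n_k}(t_k)\ge a_k\}\Big)=\det(\mathbf 1-\chi_aK\chi_a)_{\ell^2(\{(n_1,t_1),\ldots,(n_m,t_m)\}\times\mathbb{Z})},$$ where $\chi_a((n_k,t_k),x)=\mathbf 1(x<a_k)$ and $$K((n,t),x;(n',t'),x')=-\phi^{*((n,t),(n',t'))}(x,x')+\sum_{k=1}^{n'}\Psi^{n,t}_{n-k}(x)\,\Phi^{n',t'}_{n'-k}(x').$$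 The Fredholm determinant is the sum of its Fredholm expansion $\sum_{r\ge0}\frac{(-1)^r}{r!}\sum_{z_1,\ldots,z_r}\det\big[(\chi_aK\chi_a)(z_i,z_j)\big]_{1\le i,j\le r}$, which converges absolutely. -/

import Mathlib

open MeasureTheory ProbabilityTheory

noncomputable section

/-- Labels of the particles of a system with `N` particles, `N` finite or infinite:
`1, 2, …` up to `N`. -/
def IsLabel (N : ℕ∞) (j : ℕ) : Prop := 1 ≤ j ∧ (j : ℕ∞) ≤ N

/-- `x j s` is the position of particle `j` at time `s` in the discrete time TASEP with parallel
update, jump probability `p` and initial positions `y`. At each time step every particle tries to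
jump, with probability `p` and independently of everything else (`ξ j s` is the outcome of this
attempt of particle `j` between the times `s` and `s + 1`); the jump by one to the right takes
place if the target site is empty at time `s`. As the particles stay ordered,
`x 1 s > x 2 s > …`, the site `x j s + 1` can only be occupied by particle `j - 1`, and it is
always empty for `j = 1`. -/
structure IsParallelTASEP {Ω : Type*} [MeasurableSpace Ω] (μ : Measure Ω) (p : ℝ) (N : ℕ∞)
    (y : ℕ → ℤ) (ξ : ℕ → ℕ → Ω → Bool) (x : ℕ → ℕ → Ω → ℤ) : Prop where
  measurable_attempt : ∀ j s, IsLabel N j → Measurable (ξ j s)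
  indep_attempt : iIndepFun (fun i : {j : ℕ // IsLabel N j} × ℕ => ξ i.1 i.2) μ
  prob_attempt : ∀ j s, IsLabel N j → μ {ω | ξ j s ω = true} = ENNReal.ofReal p
  init : ∀ j ω, IsLabel N j → x j 0 ω = y j
  step : ∀ j s ω, IsLabel N j →
    x j (s + 1) ω =
      if ξ j s ω = true ∧ (j = 1 ∨ x (j - 1) s ω ≠ x j s ω + 1) then x j s ω + 1 else x j s ω

/-- The strict order `(n₁, t₁) ≺ (n₂, t₂)` on couples (particle label, time). -/
def Prec (P Q : ℕ × ℕ) : Prop := P.1 ≤ Q.1 ∧ Q.2 ≤ P.2 ∧ P ≠ Q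

/-- The couples `(n k, t k)`, `k = 1, …, m`, form a space-like path. -/
def IsSpaceLike {m : ℕ} (n t : Fin m → ℕ) : Prop :=
  ∀ i j : Fin m, (i : ℕ) + 1 = (j : ℕ) → Prec (n i, t i) (n j, t j)

/-- `(2πi)⁻¹ ∮_γ f(w) dw` for a path `γ` parametrized by `[0, 1]`. -/
def contourInt (γ : ℝ → ℂ) (f : ℂ → ℂ) : ℂ :=
  (2 * (Real.pi : ℂ) * Complex.I)⁻¹ * ∫ s in (0 : ℝ)..1, f (γ s) * deriv γ s

/-- Closed, piecewise differentiable paths with integrable derivative. -/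
structure IsLoop (γ : ℝ → ℂ) : Prop where
  continuousOn : ContinuousOn γ (Set.Icc 0 1)
  closed : γ 0 = γ 1
  differentiable : ∃ D : Finset ℝ, ∀ s ∈ Set.Ioo (0 : ℝ) 1, s ∉ D → DifferentiableAt ℝ γ s
  integrable : IntervalIntegrable (deriv γ) volume 0 1

/-- `γ` does not pass through `z` and winds `d` times, anticlockwise, around `z`. -/
def Winds (γ : ℝ → ℂ) (z : ℂ) (d : ℤ) : Prop :=
  (∀ s ∈ Set.Icc (0 : ℝ) 1, γ s ≠ z) ∧ contourInt γ (fun w => (w - z)⁻¹) = d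

/-- The contours `Γ_{0,-1}`: loops going once, anticlockwise, around `0` and around `-1`, with the
remaining possible pole `-1/p` outside. -/
structure IsContour (p : ℝ) (γ : ℝ → ℂ) : Prop where
  loop : IsLoop γ
  zero_inside : Winds γ 0 1
  neg_one_inside : Winds γ (-1) 1
  outside : Winds γ (-1 / (p : ℂ)) 0

/-- The function `Ψ^{n,t}_{n-k}(x)`. -/
def Psi (p : ℝ) (γ : ℝ → ℂ) (y : ℕ → ℤ) (n t k : ℕ) (x : ℤ) : ℂ :=
  contourInt γ fun w =>
    (1 + p * w) ^ (t : ℤ) / (1 + w) ^ (x - y k + 1) *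
      (w / ((w + 1) * (1 + p * w))) ^ ((n : ℤ) - (k : ℤ))

open scoped Classical in
/-- The function `φ^{*(P₁,P₂)}(x₁, x₂)`, `P₁ = (n₁, t₁)`, `P₂ = (n₂, t₂)`. -/
def phiStar (p : ℝ) (γ : ℝ → ℂ) (P₁ P₂ : ℕ × ℕ) (x₁ x₂ : ℤ) : ℂ :=
  if Prec P₁ P₂ then
    contourInt γ fun w =>
      (1 + p * w) ^ ((P₁.2 : ℤ) - (P₂.2 : ℤ)) / (1 + w) ^ (x₁ - x₂ + 1) *
        (w / ((w + 1) * (1 + p * w))) ^ ((P₁.1 : ℤ) - (P₂.1 : ℤ))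
  else 0

/-- The two conditions on the functions `Φ k = Φ^{n,t}_{n-k}`, `k = 1, …, n`: biorthogonality to
the functions `Ψ^{n,t}_{n-l}`, and that they span the polynomials of degree less than `n`. -/
structure IsBiorthogonal (p : ℝ) (γ : ℝ → ℂ) (y : ℕ → ℤ) (n t : ℕ) (Φ : ℕ → ℤ → ℂ) : Prop where
  ortho : ∀ k ∈ Finset.Icc 1 n, ∀ l ∈ Finset.Icc 1 n,
    HasSum (fun x : ℤ => Psi p γ y n t l x * Φ k x) (if k = l then 1 else 0)
  span : Submodule.span ℂ (Φ '' (Finset.Icc 1 n : Set ℕ)) =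
    Submodule.span ℂ ((fun (j : ℕ) (x : ℤ) => (x : ℂ) ^ j) '' (Finset.range n : Set ℕ))

/-- The extended kernel `K((n_i,t_i),x₁;(n_j,t_j),x₂)` along the path `(n k, t k)`; here `Φ i k`
stands for `Φ^{n_i,t_i}_{n_i-k}`. -/
def extKernel (p : ℝ) (γ : ℝ → ℂ) (y : ℕ → ℤ) {m : ℕ} (n t : Fin m → ℕ) (Φ : Fin m → ℕ → ℤ → ℂ)
    (P Q : Fin m × ℤ) : ℂ :=
  -phiStar p γ (n P.1, t P.1) (n Q.1, t Q.1) P.2 Q.2 +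
    ∑ k ∈ Finset.Icc 1 (n Q.1), Psi p γ y (n P.1) (t P.1) k P.2 * Φ Q.1 k Q.2

/-- The cut-off `χ_a((n_k,t_k), x) = 1(x < a_k)`. -/
def chi {m : ℕ} (a : Fin m → ℤ) (P : Fin m × ℤ) : ℂ := if P.2 < a P.1 then 1 else 0

/-- The Fredholm determinant `det(1 - K)` over the discrete space `ι` exists and equals `d`: the
Fredholm expansion `∑_r (-1)^r / r! ∑_{z ∈ ι^r} det (K(z_i, z_j))_{1 ≤ i,j ≤ r}` converges
absolutely, with sum `d`. -/
def HasFredholmDet {ι : Type*} (K : ι → ι → ℂ) (d : ℂ) : Prop :=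
  HasSum (fun z : (r : ℕ) × (Fin r → ι) =>
    (-1) ^ z.1 / (z.1.factorial : ℂ) * (Matrix.of fun i j => K (z.2 i) (z.2 j)).det) d

end

/-! The proof runs backward in time. Viewed as functions of the initial positions `y`, the
determinant and the probability obey the same recursion in the first time step and agree when the
last level of the path has time `0`.

The obstacle is that the functions `Φ` depend on all the `y k` at once, and that the sums defining
them may diverge at some of the smaller times met in the induction. Both difficulties disappear with
an algebraic description. Certain explicit polynomials `dualPoly` pair with `Psi` to a unitriangular
matrix `pairCoeff`, which depends neither on `n` nor on `t`. Hence `Φ` solves a linear system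
(`IsDual`) that makes sense without any convergence. By a Schur complement (`det_blockKernel`), `det
(1 - K)` is then the determinant of a block matrix in which `y k` enters only through column `k`.

On such a column, `1 + p w = (1 - p) + p (1 + w)` is the free evolution of one particle. If particle
`k` is blocked by particle `k - 1`, subtracting `p` times column `k - 1` replaces the free evolution
by no motion at all. These column operations have determinant `1`, so multilinearity in the columns
gives the average over independent attempts (`det_blockKernel_add_one`). The probability satisfies
the same identity by the Markov property (`prob_add_one`).

The last level of a space-like path has the largest label and the smallest time. Once this time is
`0`, the level either imposes no constraint and its rows of `K` vanish, or its constraint is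
violated and a column of `1 - K` vanishes.

The Fredholm expansion reduces to a finite determinant because `K` is strictly triangular in the
levels to the left of all particles involved (`extKernel_eq_zero_of_prec`,
`hasFredholmDet_extKernel`). Contour integrals are evaluated by recurrences in the exponents, using
only the winding numbers around the three possible poles. -/

noncomputable section

/-! ### Contour integrals of products of powers -/

/-- The contour integral of `(1 + p w)^a (1 + w)^b w^c`. -/
def ratInt (p : ℝ) (γ : ℝ → ℂ) (a b c : ℤ) : ℂ :=
  contourInt γ fun w => (1 + p * w) ^ a * (1 + w) ^ b * w ^ c

lemma contourInt_congr {γ : ℝ → ℂ} {f g : ℂ → ℂ}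
    (h : ∀ s ∈ Set.Icc (0 : ℝ) 1, f (γ s) = g (γ s)) : contourInt γ f = contourInt γ g := by
  unfold contourInt
  congr 1
  apply intervalIntegral.integral_congr
  intro s hs
  rw [Set.uIcc_of_le zero_le_one] at hs
  simp only [h s hs]

lemma IsLoop.intervalIntegrable {γ : ℝ → ℂ} (hγ : IsLoop γ) {f : ℂ → ℂ}
    (hf : ContinuousOn (fun s => f (γ s)) (Set.Icc 0 1)) :
    IntervalIntegrable (fun s => f (γ s) * deriv γ s) volume 0 1 := by
  apply hγ.integrable.continuousOn_mul
  rwa [Set.uIcc_of_le zero_le_one]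

lemma contourInt_const_mul (γ : ℝ → ℂ) (f : ℂ → ℂ) (r : ℂ) :
    contourInt γ (fun w => r * f w) = r * contourInt γ f := by
  unfold contourInt
  simp only [mul_assoc, intervalIntegral.integral_const_mul]
  ring

lemma IsLoop.contourInt_add {γ : ℝ → ℂ} (hγ : IsLoop γ) {f g : ℂ → ℂ}
    (hf : ContinuousOn (fun s => f (γ s)) (Set.Icc 0 1))
    (hg : ContinuousOn (fun s => g (γ s)) (Set.Icc 0 1)) :
    contourInt γ (fun w => f w + g w) = contourInt γ f + contourInt γ g := by
  unfold contourInt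
  simp only [add_mul]
  rw [intervalIntegral.integral_add (hγ.intervalIntegrable hf) (hγ.intervalIntegrable hg), mul_add]

/-- Powers other than `-1` have primitives. -/
lemma IsLoop.contourInt_zpow {γ : ℝ → ℂ} (hγ : IsLoop γ) {z : ℂ}
    (hz : ∀ s ∈ Set.Icc (0 : ℝ) 1, γ s ≠ z) {e : ℤ} (he : e ≠ -1) :
    contourInt γ (fun w => (w - z) ^ e) = 0 := by
  obtain ⟨D, hD⟩ := hγ.differentiable
  have he' : ((e : ℂ) + 1) ≠ 0 := by
    intro h
    apply he
    have : ((e + 1 : ℤ) : ℂ) = 0 := by push_cast; exact h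
    have := Int.cast_eq_zero.1 this
    omega
  have hne : ∀ s ∈ Set.Icc (0 : ℝ) 1, γ s - z ≠ 0 := fun s hs => sub_ne_zero.2 (hz s hs)
  have hcont : ∀ e : ℤ, ContinuousOn (fun s => (γ s - z) ^ e) (Set.Icc 0 1) := fun e =>
    (hγ.continuousOn.sub continuousOn_const).zpow₀ e fun s hs => Or.inl (hne s hs)
  have := integral_eq_of_hasDerivAt_off_countable
    (fun s => (γ s - z) ^ (e + 1) / ((e : ℂ) + 1)) (fun s => (γ s - z) ^ e * deriv γ s)
    (a := 0) (b := 1) (s := (D : Set ℝ)) D.countable_toSet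
    (by
      rw [Set.uIcc_of_le zero_le_one]
      exact (hcont (e + 1)).div_const _)
    (by
      intro s hs
      simp only [zero_le_one, inf_of_le_left, sup_of_le_right] at hs
      have h1 : HasDerivAt (fun s => γ s - z) (deriv γ s) s :=
        (hD s hs.1 (by simpa using hs.2)).hasDerivAt.sub_const z
      have h2 := hne s (Set.Ioo_subset_Icc_self hs.1)
      have h3 := ((hasDerivAt_zpow (e + 1) (γ s - z) (Or.inl h2)).comp s h1).div_const ((e : ℂ) + 1)
      refine h3.congr_deriv ?_
      push_cast
      rw [add_sub_cancel_right]
      field_simp)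
    (hγ.intervalIntegrable (f := fun w => (w - z) ^ e) (hcont e))
  unfold contourInt
  rw [this, hγ.closed]
  simp

namespace IsContour

variable {p : ℝ} {γ : ℝ → ℂ}

lemma ne_zero (hγ : IsContour p γ) {s : ℝ} (hs : s ∈ Set.Icc (0 : ℝ) 1) : γ s ≠ 0 :=
  hγ.zero_inside.1 s hs

lemma one_add_ne_zero (hγ : IsContour p γ) {s : ℝ} (hs : s ∈ Set.Icc (0 : ℝ) 1) : 1 + γ s ≠ 0 := by
  intro h
  exact hγ.neg_one_inside.1 s hs (by linear_combination h)

lemma one_add_mul_ne_zero (hγ : IsContour p γ) (hp : p ≠ 0) {s : ℝ} (hs : s ∈ Set.Icc (0 : ℝ) 1) :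
    1 + p * γ s ≠ 0 := by
  intro h
  have hp' : (p : ℂ) ≠ 0 := by exact_mod_cast hp
  refine hγ.outside.1 s hs ?_
  rw [eq_div_iff hp']
  linear_combination h

lemma continuousOn_rat (hγ : IsContour p γ) (hp : p ≠ 0) (a b c : ℤ) :
    ContinuousOn (fun s => (1 + p * γ s) ^ a * (1 + γ s) ^ b * γ s ^ c) (Set.Icc 0 1) := by
  have h := hγ.loop.continuousOn
  refine ((ContinuousOn.zpow₀ ?_ a fun s hs => Or.inl (hγ.one_add_mul_ne_zero hp hs)).mul
    (ContinuousOn.zpow₀ ?_ b fun s hs => Or.inl (hγ.one_add_ne_zero hs))).mul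
    (h.zpow₀ c fun s hs => Or.inl (hγ.ne_zero hs))
  · exact continuousOn_const.add (continuousOn_const.mul h)
  · exact continuousOn_const.add h

lemma ratInt_add_one_mid (hγ : IsContour p γ) (hp : p ≠ 0) (a b c : ℤ) :
    ratInt p γ a (b + 1) c = ratInt p γ a b c + ratInt p γ a b (c + 1) := by
  unfold ratInt
  rw [← hγ.loop.contourInt_add (hγ.continuousOn_rat hp a b c) (hγ.continuousOn_rat hp a b (c + 1))]
  refine contourInt_congr fun s hs => ?_
  rw [zpow_add_one₀ (hγ.one_add_ne_zero hs), zpow_add_one₀ (hγ.ne_zero hs)]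
  ring

lemma ratInt_add_one_left (hγ : IsContour p γ) (hp : p ≠ 0) (a b c : ℤ) :
    ratInt p γ (a + 1) b c = ratInt p γ a b c + p * ratInt p γ a b (c + 1) := by
  unfold ratInt
  rw [← contourInt_const_mul, ← hγ.loop.contourInt_add (hγ.continuousOn_rat hp a b c)
    (g := fun w => p * ((1 + p * w) ^ a * (1 + w) ^ b * w ^ (c + 1)))
    (continuousOn_const.mul (hγ.continuousOn_rat hp a b (c + 1)))]
  refine contourInt_congr fun s hs => ?_
  rw [zpow_add_one₀ (hγ.one_add_mul_ne_zero hp hs), zpow_add_one₀ (hγ.ne_zero hs)]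
  ring

/-- Free evolution of one particle. -/
lemma ratInt_add_one_left' (hγ : IsContour p γ) (hp : p ≠ 0) (a b c : ℤ) :
    ratInt p γ (a + 1) b c = (1 - p) * ratInt p γ a b c + p * ratInt p γ a (b + 1) c := by
  rw [hγ.ratInt_add_one_left hp, hγ.ratInt_add_one_mid hp]
  ring

lemma ratInt_right (hγ : IsContour p γ) (c : ℤ) :
    ratInt p γ 0 0 c = if c = -1 then 1 else 0 := by
  unfold ratInt
  simp only [zpow_zero, one_mul]
  split_ifs with h
  · subst h
    simpa using hγ.zero_inside.2
  · simpa using hγ.loop.contourInt_zpow hγ.zero_inside.1 h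

lemma ratInt_mid (hγ : IsContour p γ) (b : ℤ) :
    ratInt p γ 0 b 0 = if b = -1 then 1 else 0 := by
  unfold ratInt
  simp only [zpow_zero, one_mul, mul_one]
  split_ifs with h
  · subst h
    simpa [add_comm] using hγ.neg_one_inside.2
  · simpa [add_comm] using hγ.loop.contourInt_zpow hγ.neg_one_inside.1 h

/-- The only possible pole is `-1/p`, which lies outside the contour. -/
lemma ratInt_left (hγ : IsContour p γ) (hp : p ≠ 0) (a : ℤ) : ratInt p γ a 0 0 = 0 := by
  have hp' : (p : ℂ) ≠ 0 := by exact_mod_cast hp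
  have h1 : ratInt p γ a 0 0 = (p : ℂ) ^ a * contourInt γ (fun w => (w - -1 / (p : ℂ)) ^ a) := by
    unfold ratInt
    rw [← contourInt_const_mul]
    refine contourInt_congr fun s _ => ?_
    rw [← mul_zpow]
    simp only [zpow_zero, mul_one]
    congr 1
    field_simp
    ring
  rw [h1]
  by_cases h : a = -1
  · subst h
    have := hγ.outside.2
    simp only [zpow_neg_one, this]
    simp
  · rw [hγ.loop.contourInt_zpow hγ.outside.1 h, mul_zero]

end IsContour

/-! ### `Psi` and `phiStar` as integrals of products of powers -/

lemma zpow_div_mul_zpow {A B W : ℂ} (hA : A ≠ 0) (hB : B ≠ 0) (T X d : ℤ) :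
    A ^ T / B ^ X * (W / (B * A)) ^ d = A ^ (T - d) * B ^ (-X - d) * W ^ d := by
  rw [div_zpow, mul_zpow, zpow_sub₀ hA, zpow_sub₀ hB, zpow_neg]
  have := zpow_ne_zero d hA
  have := zpow_ne_zero d hB
  have := zpow_ne_zero X hB
  field_simp

namespace IsContour

variable {p : ℝ} {γ : ℝ → ℂ}

lemma Psi_eq (hγ : IsContour p γ) (hp : p ≠ 0) (y : ℕ → ℤ) (n t k : ℕ) (x : ℤ) :
    Psi p γ y n t k x =
      ratInt p γ ((t : ℤ) - n + k) (y k - x - 1 - n + k) ((n : ℤ) - k) := by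
  unfold Psi ratInt
  refine contourInt_congr fun s hs => ?_
  rw [add_comm (γ s) 1, zpow_div_mul_zpow (hγ.one_add_mul_ne_zero hp hs) (hγ.one_add_ne_zero hs)]
  congr 3 <;> ring

lemma phiStar_eq (hγ : IsContour p γ) (hp : p ≠ 0) {P₁ P₂ : ℕ × ℕ} (h : Prec P₁ P₂) (x₁ x₂ : ℤ) :
    phiStar p γ P₁ P₂ x₁ x₂ =
      ratInt p γ ((P₁.2 : ℤ) - P₂.2 + P₂.1 - P₁.1) (x₂ - x₁ - 1 + P₂.1 - P₁.1)
        ((P₁.1 : ℤ) - P₂.1) := by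
  unfold phiStar ratInt
  rw [if_pos h]
  refine contourInt_congr fun s hs => ?_
  rw [add_comm (γ s) 1, zpow_div_mul_zpow (hγ.one_add_mul_ne_zero hp hs) (hγ.one_add_ne_zero hs)]
  congr 3 <;> ring

end IsContour

/-! ### Coefficients of `(1 + p z)^a (1 + z)^b` -/

/-- The power series `1 + r z`, as a unit. -/
def linUnit (r : ℂ) : (PowerSeries ℂ)ˣ :=
  (show IsUnit (1 + PowerSeries.C r * PowerSeries.X : PowerSeries ℂ) by
    rw [PowerSeries.isUnit_iff_constantCoeff]; simp).unit

lemma linUnit_val (r : ℂ) :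
    (linUnit r : PowerSeries ℂ) = 1 + PowerSeries.C r * PowerSeries.X := rfl

/-- The power series `(1 + p z)^a (1 + z)^b`. -/
def ratSeries (p : ℝ) (a b : ℤ) : (PowerSeries ℂ)ˣ := linUnit p ^ a * linUnit 1 ^ b

/-- The coefficient of `z^e` in `(1 + p z)^a (1 + z)^b`. -/
def ratCoeff (p : ℝ) (a b e : ℤ) : ℂ :=
  if e < 0 then 0 else PowerSeries.coeff e.toNat (ratSeries p a b : PowerSeries ℂ)

lemma ratCoeff_of_neg (p : ℝ) (a b : ℤ) {e : ℤ} (he : e < 0) : ratCoeff p a b e = 0 := by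
  simp [ratCoeff, he]

lemma ratCoeff_natCast (p : ℝ) (a b : ℤ) (e : ℕ) :
    ratCoeff p a b e = PowerSeries.coeff e (ratSeries p a b : PowerSeries ℂ) := by
  simp [ratCoeff]

lemma coeff_linUnit_mul (r : ℂ) (f : PowerSeries ℂ) (g : ℤ → ℂ)
    (hg : ∀ e : ℕ, g e = PowerSeries.coeff e f) (hg' : g (-1) = 0) (e : ℕ) :
    PowerSeries.coeff e ((linUnit r : PowerSeries ℂ) * f) = g e + r * g ((e : ℤ) - 1) := by
  rw [linUnit_val, add_mul, one_mul, map_add, mul_assoc, PowerSeries.coeff_C_mul, hg]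
  cases e with
  | zero => simp [hg']
  | succ e =>
    rw [PowerSeries.coeff_succ_X_mul]
    push_cast
    rw [add_sub_cancel_right, hg]

lemma ratCoeff_add_one_left (p : ℝ) (a b e : ℤ) :
    ratCoeff p (a + 1) b e = ratCoeff p a b e + p * ratCoeff p a b (e - 1) := by
  rcases lt_or_ge e 0 with he | he
  · rw [ratCoeff_of_neg _ _ _ he, ratCoeff_of_neg _ _ _ he, ratCoeff_of_neg _ _ _ (by omega)]
    simp
  · lift e to ℕ using he
    rw [ratCoeff_natCast, ← coeff_linUnit_mul _ _ _ (ratCoeff_natCast p a b)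
      (ratCoeff_of_neg _ _ _ (by norm_num)), ← Units.val_mul]
    congr 2
    unfold ratSeries
    rw [zpow_add_one, ← mul_assoc, mul_comm (linUnit p ^ a)]

lemma ratCoeff_add_one_right (p : ℝ) (a b e : ℤ) :
    ratCoeff p a (b + 1) e = ratCoeff p a b e + ratCoeff p a b (e - 1) := by
  rcases lt_or_ge e 0 with he | he
  · rw [ratCoeff_of_neg _ _ _ he, ratCoeff_of_neg _ _ _ he, ratCoeff_of_neg _ _ _ (by omega)]
    simp
  · lift e to ℕ using he
    have := coeff_linUnit_mul 1 _ _ (ratCoeff_natCast p a b)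
      (ratCoeff_of_neg _ _ _ (by norm_num)) e
    rw [one_mul] at this
    rw [ratCoeff_natCast, ← this, ← Units.val_mul]
    congr 2
    unfold ratSeries
    rw [zpow_add_one, ← mul_assoc, mul_comm]

lemma ratCoeff_add_one_left' (p : ℝ) (a b e : ℤ) :
    ratCoeff p (a + 1) b e = (1 - p) * ratCoeff p a b e + p * ratCoeff p a (b + 1) e := by
  rw [ratCoeff_add_one_left, ratCoeff_add_one_right]
  ring

lemma ratCoeff_zero_zero (p : ℝ) (e : ℤ) : ratCoeff p 0 0 e = if e = 0 then 1 else 0 := by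
  rcases lt_or_ge e 0 with he | he
  · rw [ratCoeff_of_neg _ _ _ he, if_neg (by omega)]
  · lift e to ℕ using he
    rw [ratCoeff_natCast]
    simp [ratSeries, PowerSeries.coeff_one]

lemma ratCoeff_zero (p : ℝ) (a b : ℤ) : ratCoeff p a b 0 = 1 := by
  have hb : ∀ b : ℤ, ratCoeff p 0 b 0 = 1 := by
    intro b
    have h : ∀ b, ratCoeff p 0 (b + 1) 0 = ratCoeff p 0 b 0 := fun b => by
      rw [ratCoeff_add_one_right, ratCoeff_of_neg _ _ _ (by norm_num : (0 : ℤ) - 1 < 0), add_zero]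
    induction b using Int.induction_on with
    | zero => simp [ratCoeff_zero_zero]
    | succ b ih => rw [h, ih]
    | pred b ih => rw [← h, sub_add_cancel, ih]
  have h : ∀ a, ratCoeff p (a + 1) b 0 = ratCoeff p a b 0 := fun b => by
    rw [ratCoeff_add_one_left, ratCoeff_of_neg _ _ _ (by norm_num : (0 : ℤ) - 1 < 0)]
    simp
  induction a using Int.induction_on with
  | zero => exact hb b
  | succ a ih => rw [h, ih]
  | pred a ih => rw [← h, sub_add_cancel, ih]

lemma ratSeries_mul (p : ℝ) (a b a' b' : ℤ) :
    ratSeries p a b * ratSeries p a' b' = ratSeries p (a + a') (b + b') := by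
  unfold ratSeries
  rw [zpow_add, zpow_add]
  exact mul_mul_mul_comm _ _ _ _

lemma ratCoeff_add_add (p : ℝ) (a b a' b' : ℤ) (e : ℕ) :
    ∑ i ∈ Finset.range (e + 1), ratCoeff p a b i * ratCoeff p a' b' ((e : ℤ) - i) =
      ratCoeff p (a + a') (b + b') e := by
  rw [ratCoeff_natCast, ← ratSeries_mul, Units.val_mul, PowerSeries.coeff_mul,
    Finset.Nat.sum_antidiagonal_eq_sum_range_succ_mk]
  refine Finset.sum_congr rfl fun i hi => ?_
  rw [Finset.mem_range] at hi
  rw [← ratCoeff_natCast, ← ratCoeff_natCast, Nat.cast_sub (by omega)]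

/-- Cauchy product of two series: only `s < r ≤ k` contributes, so any upper limit `N ≥ k` may be
used. This lets sums over particle labels be composed like contour integrals. -/
lemma sum_ratCoeff_mul (p : ℝ) (a b a' b' : ℤ) (s k N : ℕ) (hk : k ≤ N) :
    ∑ r ∈ Finset.Icc 1 N, ratCoeff p a b ((r : ℤ) - s - 1) * ratCoeff p a' b' ((k : ℤ) - r) =
      ratCoeff p (a + a') (b + b') ((k : ℤ) - s - 1) := by
  rcases lt_or_ge ((k : ℤ) - s - 1) 0 with h | h
  · rw [ratCoeff_of_neg _ _ _ h]
    refine Finset.sum_eq_zero fun r _ => ?_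
    rcases lt_or_ge k r with hr | hr
    · rw [ratCoeff_of_neg _ a' b' (by omega), mul_zero]
    · rw [ratCoeff_of_neg _ a b (by omega), zero_mul]
  · obtain ⟨e, rfl⟩ : ∃ e : ℕ, k = s + 1 + e := ⟨k - s - 1, by omega⟩
    rw [show (((s + 1 + e : ℕ) : ℤ) - s - 1) = e by push_cast; ring, ← ratCoeff_add_add]
    symm
    have hinj : Set.InjOn (fun i : ℕ => s + 1 + i) (Finset.range (e + 1) : Set ℕ) :=
      fun i _ j _ hij => by simpa using hij
    have := Finset.sum_image (s := Finset.range (e + 1)) (g := fun i => s + 1 + i)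
      (f := fun r : ℕ => ratCoeff p a b ((r : ℤ) - s - 1) *
        ratCoeff p a' b' (((s + 1 + e : ℕ) : ℤ) - r)) hinj
    have h2 : ∑ i ∈ Finset.range (e + 1), ratCoeff p a b i * ratCoeff p a' b' ((e : ℤ) - i) =
        ∑ r ∈ (Finset.range (e + 1)).image (fun i => s + 1 + i),
          ratCoeff p a b ((r : ℤ) - s - 1) * ratCoeff p a' b' (((s + 1 + e : ℕ) : ℤ) - r) := by
      rw [this]
      refine Finset.sum_congr rfl fun i _ => ?_
      congr 2 <;> push_cast <;> ring
    rw [h2]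
    refine Finset.sum_subset ?_ ?_
    · intro r hr
      simp only [Finset.mem_image, Finset.mem_range, Finset.mem_Icc] at hr ⊢
      omega
    · intro r hr hr'
      simp only [Finset.mem_image, Finset.mem_range, Finset.mem_Icc, not_exists, not_and] at hr hr'
      rcases lt_or_ge r (s + 1) with h1 | h1
      · rw [ratCoeff_of_neg _ a b (by omega), zero_mul]
      · rw [ratCoeff_of_neg _ a' b', mul_zero]
        by_contra h3
        exact hr' (r - s - 1) (by push_cast at h3; omega) (by omega)

/-- The residue theorem for integrands whose only possible pole inside the contour is `0`. -/
lemma IsContour.ratInt_eq_ratCoeff {p : ℝ} {γ : ℝ → ℂ} (hγ : IsContour p γ) (hp : p ≠ 0)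
    (a b c : ℤ) (hb : 0 ≤ b) : ratInt p γ a b c = ratCoeff p a b (-1 - c) := by
  have hp' : (p : ℂ) ≠ 0 := by exact_mod_cast hp
  have h0 : ∀ a c, ratInt p γ a 0 c = ratCoeff p a 0 (-1 - c) := by
    intro a
    induction a using Int.induction_on with
    | zero =>
      intro c
      rw [hγ.ratInt_right, ratCoeff_zero_zero]
      congr 1
      apply propext
      omega
    | succ a ih =>
      intro c
      rw [hγ.ratInt_add_one_left hp, ih, ih, ratCoeff_add_one_left, sub_sub]
    | pred a ih =>
      intro c
      -- Lowering `a` only gives a two-term recursion in `c`. It determines all values from the one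
      -- at `c = 0`, which is `ratInt_left`; going upward requires division by `p`.
      have h1 : ∀ c, ratInt p γ (-(a : ℤ) - 1) 0 c + p * ratInt p γ (-(a : ℤ) - 1) 0 (c + 1) =
          ratCoeff p (-(a : ℤ) - 1) 0 (-1 - c) +
            p * ratCoeff p (-(a : ℤ) - 1) 0 (-1 - (c + 1)) := by
        intro c
        rw [← hγ.ratInt_add_one_left hp, sub_add_cancel, ih, ← sub_sub, ← ratCoeff_add_one_left,
          sub_add_cancel]
      induction c using Int.induction_on with
      | zero => rw [hγ.ratInt_left hp, ratCoeff_of_neg _ _ _ (by norm_num)]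
      | succ c ihc =>
        have := h1 c
        rw [ihc] at this
        exact mul_left_cancel₀ hp' (add_left_cancel this)
      | pred c ihc =>
        have := h1 (-(c : ℤ) - 1)
        rw [sub_add_cancel, ihc] at this
        exact add_right_cancel this
  lift b to ℕ using hb
  induction b generalizing c with
  | zero => exact h0 a c
  | succ b ih =>
    push_cast
    rw [hγ.ratInt_add_one_mid hp, ih, ih, ratCoeff_add_one_right, sub_sub]

/-! ### Polynomial functions on the integers -/

/-- The polynomial functions of degree less than `n` on `ℤ`. -/
abbrev polyLT (n : ℕ) : Submodule ℂ (ℤ → ℂ) :=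
  Submodule.span ℂ ((fun (j : ℕ) (x : ℤ) => (x : ℂ) ^ j) '' (Finset.range n : Set ℕ))

lemma polyLT_mono {n n' : ℕ} (h : n ≤ n') : polyLT n ≤ polyLT n' :=
  Submodule.span_mono (Set.image_mono (by simpa using h))

/-- Multiplication by `x`. -/
def mulX : (ℤ → ℂ) →ₗ[ℂ] (ℤ → ℂ) where
  toFun f x := x * f x
  map_add' f g := by ext x; simp [mul_add]
  map_smul' r f := by ext x; simp [mul_left_comm]

lemma mulX_apply (f : ℤ → ℂ) (x : ℤ) : mulX f x = x * f x := rfl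

lemma mulX_mem_polyLT {n : ℕ} {f : ℤ → ℂ} (hf : f ∈ polyLT n) : mulX f ∈ polyLT (n + 1) := by
  have : polyLT n ≤ (polyLT (n + 1)).comap mulX := by
    refine Submodule.span_le.2 ?_
    rintro _ ⟨j, hj, rfl⟩
    refine Submodule.subset_span ⟨j + 1, ?_, ?_⟩
    · simpa using hj
    · ext x
      simp [mulX_apply, pow_succ']
  exact this hf

/-- For `f = (1 + z)^b` this is the differential equation `(1 + z) f' = b f`, that is, the recursion
of the generalized binomial coefficients. -/
lemma ratCoeff_zero_left_succ (p : ℝ) (b e : ℤ) :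
    ((b : ℂ) - e) * ratCoeff p 0 b e = ((e : ℂ) + 1) * ratCoeff p 0 b (e + 1) := by
  have hneg : ∀ b e : ℤ, e < 0 →
      ((b : ℂ) - e) * ratCoeff p 0 b e = ((e : ℂ) + 1) * ratCoeff p 0 b (e + 1) := by
    intro b e he
    rw [ratCoeff_of_neg _ _ _ he]
    rcases eq_or_ne e (-1) with rfl | h
    · simp
    · rw [ratCoeff_of_neg _ _ _ (by omega)]
      simp
  induction b using Int.induction_on generalizing e with
  | zero =>
    rw [ratCoeff_zero_zero, ratCoeff_zero_zero]
    split_ifs with h1 h2 h2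
    · omega
    · simp [h1]
    · have : (e : ℂ) = -1 := by exact_mod_cast (by omega : e = -1)
      simp [this]
    · simp
  | succ b ih =>
    have h1 := ih e
    have h2 := ih (e - 1)
    rw [ratCoeff_add_one_right, ratCoeff_add_one_right, add_sub_cancel_right]
    rw [sub_add_cancel] at h2
    push_cast at h1 h2 ⊢
    linear_combination h1 + h2
  | pred b ih =>
    rcases lt_or_ge e 0 with he | he
    · exact hneg _ _ he
    lift e to ℕ using he
    -- By Pascal's rule the relation for the larger exponent is the sum of the relations at `e` and
    -- `e - 1` for the smaller one. Hence an induction on `e`, started from the trivial case `e =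
    -- -1`.
    have key : ∀ e : ℤ, (((-(b : ℤ) - 1 : ℤ) : ℂ) - ((e - 1 : ℤ) : ℂ)) *
          ratCoeff p 0 (-(b : ℤ) - 1) (e - 1) =
          (((e - 1 : ℤ) : ℂ) + 1) * ratCoeff p 0 (-(b : ℤ) - 1) e →
        (((-(b : ℤ) - 1 : ℤ) : ℂ) - e) * ratCoeff p 0 (-(b : ℤ) - 1) e =
          ((e : ℂ) + 1) * ratCoeff p 0 (-(b : ℤ) - 1) (e + 1) := by
      intro e h2
      have h1 := ih e
      rw [show -(b : ℤ) = (-(b : ℤ) - 1) + 1 by ring, ratCoeff_add_one_right,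
        ratCoeff_add_one_right, add_sub_cancel_right] at h1
      push_cast at h1 h2 ⊢
      linear_combination h1 - h2
    induction e with
    | zero =>
      apply key
      have := hneg (-(b : ℤ) - 1) (-1) (by norm_num)
      simpa using this
    | succ e ihe =>
      have := key ((e : ℤ) + 1) (by
        rw [add_sub_cancel_right]
        exact_mod_cast ihe)
      exact_mod_cast this

lemma span_ratCoeff_zero_left (p : ℝ) (β : ℤ) (n : ℕ) :
    Submodule.span ℂ ((fun (j : ℕ) (x : ℤ) => ratCoeff p 0 (x + β) j) ''
      (Finset.range n : Set ℕ)) = polyLT n := by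
  have hq : ∀ (j : ℕ) (x : ℤ), ((x : ℂ) + β - j) * ratCoeff p 0 (x + β) j =
      ((j : ℂ) + 1) * ratCoeff p 0 (x + β) ((j + 1 : ℕ) : ℤ) := by
    intro j x
    have := ratCoeff_zero_left_succ p (x + β) j
    push_cast at this ⊢
    exact this
  apply le_antisymm
  · have h : ∀ j : ℕ, (fun x : ℤ => ratCoeff p 0 (x + β) j) ∈ polyLT (j + 1) := by
      intro j
      induction j with
      | zero =>
        refine Submodule.subset_span ⟨0, by simp, ?_⟩
        ext x
        simp [ratCoeff_zero]
      | succ j ih =>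
        have h2 : (fun x : ℤ => ratCoeff p 0 (x + β) ((j + 1 : ℕ) : ℤ)) = ((j : ℂ) + 1)⁻¹ •
            (mulX (fun x : ℤ => ratCoeff p 0 (x + β) j) +
              ((β : ℂ) - j) • fun x : ℤ => ratCoeff p 0 (x + β) j) := by
          ext x
          have h3 : (j : ℂ) + 1 ≠ 0 := by exact_mod_cast Nat.succ_ne_zero j
          simp only [Pi.smul_apply, Pi.add_apply, mulX_apply, smul_eq_mul]
          rw [eq_inv_mul_iff_mul_eq₀ h3, ← hq]
          ring
        rw [h2]
        exact Submodule.smul_mem _ _ (Submodule.add_mem _ (mulX_mem_polyLT ih)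
          (Submodule.smul_mem _ _ (polyLT_mono (Nat.le_succ _) ih)))
    refine Submodule.span_le.2 ?_
    rintro _ ⟨j, hj, rfl⟩
    exact polyLT_mono (by simpa using hj) (h j)
  · set q : ℕ → ℤ → ℂ := fun (j : ℕ) (x : ℤ) => ratCoeff p 0 (x + β) j with hqdef
    have hmono : ∀ {n n' : ℕ}, n ≤ n' →
        Submodule.span ℂ (q '' (Finset.range n : Set ℕ)) ≤
          Submodule.span ℂ (q '' (Finset.range n' : Set ℕ)) := fun h =>
      Submodule.span_mono (Set.image_mono (by simpa using h))
    have hX : ∀ n, Submodule.span ℂ (q '' (Finset.range n : Set ℕ)) ≤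
        (Submodule.span ℂ (q '' (Finset.range (n + 1) : Set ℕ))).comap mulX := by
      intro n
      refine Submodule.span_le.2 ?_
      rintro _ ⟨j, hj, rfl⟩
      have h2 : mulX (q j) = ((j : ℂ) + 1) • q (j + 1) + ((j : ℂ) - β) • q j := by
        ext x
        simp only [Pi.smul_apply, Pi.add_apply, mulX_apply, smul_eq_mul, hqdef]
        rw [← hq]
        ring
      have hj' : j < n := by simpa using hj
      change mulX (q j) ∈ Submodule.span ℂ (q '' (Finset.range (n + 1) : Set ℕ))
      rw [h2]
      refine Submodule.add_mem _ (Submodule.smul_mem _ _ (Submodule.subset_span ⟨j + 1, ?_, rfl⟩))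
        (Submodule.smul_mem _ _ (Submodule.subset_span ⟨j, ?_, rfl⟩))
      · simpa using hj'
      · simp only [Finset.coe_range, Set.mem_Iio]
        omega
    have h : ∀ j : ℕ, (fun x : ℤ => (x : ℂ) ^ j) ∈
        Submodule.span ℂ (q '' (Finset.range (j + 1) : Set ℕ)) := by
      intro j
      induction j with
      | zero =>
        refine Submodule.subset_span ⟨0, by simp, ?_⟩
        ext x
        simp [hqdef, ratCoeff_zero]
      | succ j ih =>
        have := hX _ ih
        rw [Submodule.mem_comap] at this
        convert this using 1
        ext x
        simp [mulX_apply, pow_succ']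
    refine Submodule.span_le.2 ?_
    rintro _ ⟨j, hj, rfl⟩
    exact hmono (by simpa using hj) (h j)

/-- Expanding the factor `(1 + p z)^α` leaves binomial coefficients in `x + β` of degree at most
`e`. -/
lemma ratCoeff_mem_polyLT (p : ℝ) (α β e : ℤ) {n : ℕ} (he : e < n) :
    (fun x : ℤ => ratCoeff p α (x + β) e) ∈ polyLT n := by
  rcases lt_or_ge e 0 with h | h
  · simp only [ratCoeff_of_neg _ _ _ h]
    exact Submodule.zero_mem _
  lift e to ℕ using h
  have h2 : (fun x : ℤ => ratCoeff p α (x + β) e) =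
      ∑ i ∈ Finset.range (e + 1), ratCoeff p α 0 i •
        (fun x : ℤ => ratCoeff p 0 (x + β) ((e - i : ℕ) : ℤ)) := by
    ext x
    rw [Finset.sum_apply]
    have := ratCoeff_add_add p α 0 0 (x + β) e
    rw [add_zero, zero_add] at this
    rw [← this]
    refine Finset.sum_congr rfl fun i hi => ?_
    rw [Finset.mem_range] at hi
    rw [Pi.smul_apply, smul_eq_mul, Nat.cast_sub (by omega)]
  rw [h2]
  refine Submodule.sum_mem _ fun i _ => Submodule.smul_mem _ _ ?_
  rw [← span_ratCoeff_zero_left p β]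
  refine Submodule.subset_span ⟨e - i, ?_, rfl⟩
  simp only [Finset.coe_range, Set.mem_Iio]
  omega

/-! ### Pairings with polynomials -/

lemma hasSum_comp_sub_one {f : ℤ → ℂ} {v : ℂ} (h : HasSum f v) :
    HasSum (fun x => f (x - 1)) v :=
  (Equiv.subRight (1 : ℤ)).hasSum_iff.2 h

section Pairing

variable {p : ℝ} {γ : ℝ → ℂ}

lemma IsContour.ratInt_shift (hγ : IsContour p γ) (hp : p ≠ 0) (A B C x : ℤ) :
    ratInt p γ (A + 1) (B - x - 1) C = (1 - p) * ratInt p γ A (B - x - 1) C +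
      p * ratInt p γ A (B - (x - 1) - 1) C := by
  rw [hγ.ratInt_add_one_left' hp]
  congr 3
  ring

/-- For `C = 0` the integral is a point mass at `B`. Each further factor `w = (1 + w) - 1` is a
difference in `x`; summed by parts, it acts on the coefficient as a forward difference, which by
Pascal's rule lowers `e` by one. -/
lemma IsContour.hasSum_ratInt_zero (hγ : IsContour p γ) (hp : p ≠ 0) (B e : ℤ) (C : ℕ)
    (α β : ℤ) :
    HasSum (fun x : ℤ => ratInt p γ 0 (B - x - 1) C * ratCoeff p α (x + β) e)
      (ratCoeff p α (B + β) (e - C)) := by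
  induction C generalizing β with
  | zero =>
    have : (fun x : ℤ => ratInt p γ 0 (B - x - 1) (0 : ℕ) * ratCoeff p α (x + β) e) =
        fun x => if x = B then ratCoeff p α (B + β) e else 0 := by
      ext x
      rw [Nat.cast_zero, hγ.ratInt_mid]
      split_ifs with h1 h2 h2
      · rw [h2, one_mul]
      · omega
      · omega
      · simp
    rw [this, Nat.cast_zero, sub_zero]
    exact hasSum_ite_eq B _
  | succ C ih =>
    have h1 := (hasSum_comp_sub_one (ih (β + 1))).sub (ih β)
    rw [← add_assoc, ratCoeff_add_one_right, add_sub_cancel_left] at h1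
    push_cast
    rw [← sub_sub]
    refine h1.congr_fun ?_
    intro x
    have h2 := hγ.ratInt_add_one_mid hp 0 (B - x - 1) C
    rw [show B - (x - 1) - 1 = B - x - 1 + 1 by ring, show x - 1 + (β + 1) = x + β by ring, h2]
    ring

lemma IsContour.hasSum_ratInt_succ (hγ : IsContour p γ) (hp : p ≠ 0) {A B C e α β : ℤ} {v w : ℂ}
    (h1 : HasSum (fun x : ℤ => ratInt p γ A (B - x - 1) C * ratCoeff p α (x + β) e) v)
    (h2 : HasSum (fun x : ℤ => ratInt p γ A (B - x - 1) C * ratCoeff p α (x + (β + 1)) e) w) :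
    HasSum (fun x : ℤ => ratInt p γ (A + 1) (B - x - 1) C * ratCoeff p α (x + β) e)
      ((1 - p) * v + p * w) := by
  refine ((h1.mul_left (1 - (p : ℂ))).add ((hasSum_comp_sub_one h2).mul_left (p : ℂ))).congr_fun ?_
  intro x
  rw [hγ.ratInt_shift hp, show x - 1 + (β + 1) = x + β by ring]
  ring

lemma IsContour.hasSum_ratInt_of_nonneg (hγ : IsContour p γ) (hp : p ≠ 0) (A : ℕ) (B e : ℤ)
    (C : ℕ) (α β : ℤ) :
    HasSum (fun x : ℤ => ratInt p γ A (B - x - 1) C * ratCoeff p α (x + β) e)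
      (ratCoeff p (α + A) (B + β) (e - C)) := by
  induction A generalizing β with
  | zero => simpa using hγ.hasSum_ratInt_zero hp B e C α β
  | succ A ih =>
    have := hγ.hasSum_ratInt_succ hp (ih β) (ih (β + 1))
    push_cast
    rwa [← add_assoc B, ← ratCoeff_add_one_left', add_assoc] at this

/-- A factor `1 + p w` can be moved from the integral to the coefficient, as both obey the same free
evolution. So negative `A` reduces to `A = 0`, provided that the sums converge. -/
lemma IsContour.hasSum_ratInt_of_neg (hγ : IsContour p γ) (hp : p ≠ 0) (A : ℕ) (B e : ℤ) (C : ℕ)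
    (hs : ∀ α β : ℤ,
      Summable fun x : ℤ => ratInt p γ (-(A : ℤ)) (B - x - 1) C * ratCoeff p α (x + β) e)
    (α β : ℤ) :
    HasSum (fun x : ℤ => ratInt p γ (-(A : ℤ)) (B - x - 1) C * ratCoeff p α (x + β) e)
      (ratCoeff p (α - A) (B + β) (e - C)) := by
  induction A generalizing α β with
  | zero => simpa using hγ.hasSum_ratInt_zero hp B e C α β
  | succ A ih =>
    have h := fun α β => hγ.hasSum_ratInt_succ hp (hs α β).hasSum (hs α (β + 1)).hasSum
    simp only [show -((A + 1 : ℕ) : ℤ) + 1 = -(A : ℤ) by push_cast; ring] at h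
    -- The same combination of two sums is the pairing of exponent `-A` with `α - 1` and, by `h3`
    -- below, the pairing of exponent `-(A + 1)` with `α`.
    have h2 := (h (α - 1) β).unique (ih (fun α β => (h α β).summable) (α - 1) β)
    have h3 : HasSum (fun x : ℤ => ratInt p γ (-((A + 1 : ℕ) : ℤ)) (B - x - 1) C *
        ratCoeff p α (x + β) e) ((1 - p) * (∑' x : ℤ, ratInt p γ (-((A + 1 : ℕ) : ℤ))
          (B - x - 1) C * ratCoeff p (α - 1) (x + β) e) + p * (∑' x : ℤ,
          ratInt p γ (-((A + 1 : ℕ) : ℤ)) (B - x - 1) C *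
          ratCoeff p (α - 1) (x + (β + 1)) e)) := by
      refine (((hs (α - 1) β).hasSum.mul_left (1 - (p : ℂ))).add
        ((hs (α - 1) (β + 1)).hasSum.mul_left (p : ℂ))).congr_fun ?_
      intro x
      have := ratCoeff_add_one_left' p (α - 1) (x + β) e
      rw [sub_add_cancel] at this
      rw [this, add_assoc]
      ring
    rw [h2] at h3
    push_cast
    push_cast at h3
    rwa [sub_sub, add_comm 1 (A : ℤ)] at h3

lemma IsContour.hasSum_ratInt (hγ : IsContour p γ) (hp : p ≠ 0) (A B e : ℤ) (C : ℕ)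
    (hs : ∀ α β : ℤ, Summable fun x : ℤ => ratInt p γ A (B - x - 1) C * ratCoeff p α (x + β) e)
    (α β : ℤ) :
    HasSum (fun x : ℤ => ratInt p γ A (B - x - 1) C * ratCoeff p α (x + β) e)
      (ratCoeff p (α + A) (B + β) (e - C)) := by
  obtain ⟨k, rfl | rfl⟩ := A.eq_nat_or_neg
  · exact hγ.hasSum_ratInt_of_nonneg hp k B e C α β
  · exact hγ.hasSum_ratInt_of_neg hp k B e C hs α β

end Pairing

/-! ### Summability -/

lemma summable_mul_of_mem_span {f : ℤ → ℂ} {s : Set (ℤ → ℂ)}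
    (h : ∀ g ∈ s, Summable fun x => f x * g x) {g : ℤ → ℂ} (hg : g ∈ Submodule.span ℂ s) :
    Summable fun x => f x * g x := by
  induction hg using Submodule.span_induction with
  | mem g hg => exact h g hg
  | zero => simp
  | add g g' _ _ h1 h2 => simpa [mul_add] using h1.add h2
  | smul r g _ h1 => simpa [mul_left_comm] using h1.mul_left r

/-- Exponentially decaying functions are summable against polynomials. -/
lemma summable_mul_of_mem_polyLT {f : ℤ → ℂ} {B : ℤ} {K θ : ℝ} (hθ₀ : 0 < θ) (hθ₁ : θ < 1)
    (hf₀ : ∀ x < B, f x = 0) (hf : ∀ x, ‖f x‖ ≤ K * θ ^ x) {n : ℕ} {g : ℤ → ℂ}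
    (hg : g ∈ polyLT n) : Summable fun x => f x * g x := by
  refine summable_mul_of_mem_span ?_ hg
  rintro _ ⟨j, -, rfl⟩
  have hinj : Function.Injective fun i : ℕ => B + (i : ℤ) := fun i i' h => by simpa using h
  rw [← hinj.summable_iff]
  · have hK : 0 ≤ K := by
      have := (norm_nonneg _).trans (hf 0)
      simpa using this
    have h1 : Summable fun i : ℕ => ((i + 1 : ℕ) : ℝ) ^ j * θ ^ (i + 1) :=
      (summable_nat_add_iff 1).2 (summable_pow_mul_geometric_of_norm_lt_one (R := ℝ) j
        (by rwa [Real.norm_of_nonneg hθ₀.le]))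
    refine Summable.of_norm_bounded (h1.mul_left (K * θ ^ (B - 1) * (|(B : ℝ)| + 1) ^ j)) ?_
    intro i
    simp only [Function.comp_apply, norm_mul, norm_pow]
    have h2 : ‖((B + (i : ℤ) : ℤ) : ℂ)‖ ≤ (|(B : ℝ)| + 1) * ((i + 1 : ℕ) : ℝ) := by
      rw [Complex.norm_intCast]
      push_cast
      have h3 := abs_add_le (B : ℝ) i
      rw [abs_of_nonneg (Nat.cast_nonneg i : (0 : ℝ) ≤ i)] at h3
      have h4 : 0 ≤ |(B : ℝ)| * i := by positivity
      linarith
    calc ‖f (B + i)‖ * ‖((B + (i : ℤ) : ℤ) : ℂ)‖ ^ j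
        ≤ (K * θ ^ (B + (i : ℤ))) * ((|(B : ℝ)| + 1) * ((i + 1 : ℕ) : ℝ)) ^ j :=
          mul_le_mul (hf _) (pow_le_pow_left₀ (norm_nonneg _) h2 j) (by positivity) (by positivity)
      _ = K * θ ^ (B - 1) * (|(B : ℝ)| + 1) ^ j * (((i + 1 : ℕ) : ℝ) ^ j * θ ^ (i + 1)) := by
          rw [show B + (i : ℤ) = (B - 1) + ((i + 1 : ℕ) : ℤ) by push_cast; ring,
            zpow_add₀ hθ₀.ne', zpow_natCast, mul_pow]
          ring
  · intro x hx
    rw [hf₀ x, zero_mul]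
    by_contra h
    exact hx ⟨(x - B).toNat, by simp only; omega⟩

section

variable {p : ℝ} {γ : ℝ → ℂ}

lemma IsContour.ratInt_eq_zero (hγ : IsContour p γ) (hp : p ≠ 0) {A b c : ℤ} (hb : 0 ≤ b)
    (hc : 0 ≤ c) : ratInt p γ A b c = 0 := by
  rw [hγ.ratInt_eq_ratCoeff hp _ _ _ hb, ratCoeff_of_neg _ _ _ (by omega)]

lemma IsContour.norm_ratInt_zero_le (hγ : IsContour p γ) (hp : p ≠ 0) {θ : ℝ} (hθ : 0 < θ)
    (B : ℤ) (C : ℕ) : ∃ K, ∀ x : ℤ, ‖ratInt p γ 0 (B - x - 1) C‖ ≤ K * θ ^ x := by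
  induction C with
  | zero =>
    refine ⟨θ ^ (-B), fun x => ?_⟩
    rw [Nat.cast_zero, hγ.ratInt_mid]
    split_ifs with h
    · have : x = B := by omega
      rw [this, ← zpow_add₀ hθ.ne']
      simp
    · simp only [norm_zero]
      positivity
  | succ C ih =>
    obtain ⟨K, hK⟩ := ih
    refine ⟨K * θ⁻¹ + K, fun x => ?_⟩
    have h2 := hγ.ratInt_add_one_mid hp 0 (B - x - 1) C
    push_cast
    rw [show ratInt p γ 0 (B - x - 1) ((C : ℤ) + 1) = ratInt p γ 0 (B - (x - 1) - 1) C -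
      ratInt p γ 0 (B - x - 1) C by
        rw [show B - (x - 1) - 1 = B - x - 1 + 1 by ring, h2]; ring]
    refine (norm_sub_le _ _).trans ((add_le_add (hK _) (hK _)).trans (le_of_eq ?_))
    rw [zpow_sub_one₀ hθ.ne']
    ring

/-- At the excluded pole `w = -1/p` one has `|1 + w|⁻¹ = p / (1 - p)`, which is the decay rate up to
powers of `x`. The bound comes from solving the free evolution for the value at `x`, starting from
the zeros at `x < B`. -/
lemma IsContour.norm_ratInt_neg_le (hγ : IsContour p γ) (hp₀ : 0 < p) (hp₁ : p < 1) {θ : ℝ}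
    (hθ : p / (1 - p) < θ) (A : ℕ) (B : ℤ) (C : ℕ) :
    ∃ K, ∀ x : ℤ, ‖ratInt p γ (-(A : ℤ)) (B - x - 1) C‖ ≤ K * θ ^ x := by
  have hq : 0 < 1 - p := by linarith
  have hθ₀ : 0 < θ := lt_trans (by positivity) hθ
  induction A with
  | zero => simpa using hγ.norm_ratInt_zero_le hp₀.ne' hθ₀ B C
  | succ A ih =>
    obtain ⟨K, hK⟩ := ih
    have hK₀ : 0 ≤ K := by
      have := (norm_nonneg _).trans (hK 0)
      simpa using this
    have hd : 0 < 1 - p - p / θ := by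
      rw [div_lt_iff₀ hq] at hθ
      rw [sub_pos, div_lt_iff₀ hθ₀]
      linarith
    -- The fixed point of `K' (1 - p) = K + p K' / θ`, so that the bound propagates from `x - 1` to
    -- `x`.
    set K' := K / (1 - p - p / θ) with hK'
    have hK'₀ : 0 ≤ K' := by positivity
    have hKK : K = K' * (1 - p - p / θ) := (div_mul_cancel₀ K hd.ne').symm
    refine ⟨K', ?_⟩
    have hzero : ∀ x < B, ‖ratInt p γ (-((A + 1 : ℕ) : ℤ)) (B - x - 1) C‖ ≤ K' * θ ^ x := by
      intro x hx
      rw [hγ.ratInt_eq_zero hp₀.ne' (by omega) (by omega), norm_zero]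
      positivity
    have h : ∀ i : ℕ, ‖ratInt p γ (-((A + 1 : ℕ) : ℤ)) (B - (B - 1 + i) - 1) C‖ ≤
        K' * θ ^ (B - 1 + i) := by
      intro i
      induction i with
      | zero => exact hzero _ (by simp)
      | succ i ihi =>
        set x := B - 1 + ((i + 1 : ℕ) : ℤ) with hx
        rw [show B - 1 + (i : ℤ) = x - 1 by rw [hx]; push_cast; ring] at ihi
        have h1 := hγ.ratInt_shift hp₀.ne' (-((A + 1 : ℕ) : ℤ)) B C x
        rw [show -((A + 1 : ℕ) : ℤ) + 1 = -(A : ℤ) by push_cast; ring] at h1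
        have h2 : (1 - p) * ‖ratInt p γ (-((A + 1 : ℕ) : ℤ)) (B - x - 1) C‖ ≤
            (1 - p) * (K' * θ ^ x) := by
          calc (1 - p) * ‖ratInt p γ (-((A + 1 : ℕ) : ℤ)) (B - x - 1) C‖
              = ‖((1 - p : ℝ) : ℂ) * ratInt p γ (-((A + 1 : ℕ) : ℤ)) (B - x - 1) C‖ := by
                rw [norm_mul, Complex.norm_real, Real.norm_of_nonneg hq.le]
            _ = ‖ratInt p γ (-(A : ℤ)) (B - x - 1) C -
                  p * ratInt p γ (-((A + 1 : ℕ) : ℤ)) (B - (x - 1) - 1) C‖ := by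
                rw [h1]; push_cast; congr 1; ring
            _ ≤ K * θ ^ x + p * (K' * θ ^ (x - 1)) := by
                refine (norm_sub_le _ _).trans (add_le_add (hK x) ?_)
                rw [norm_mul, Complex.norm_real, Real.norm_of_nonneg hp₀.le]
                exact mul_le_mul_of_nonneg_left ihi hp₀.le
            _ = (1 - p) * (K' * θ ^ x) := by
                rw [zpow_sub_one₀ hθ₀.ne', hKK]
                ring
        exact le_of_mul_le_mul_left h2 hq
    intro x
    rcases lt_or_ge x B with hx | hx
    · exact hzero x hx
    · have := h (x - B + 1).toNat
      rwa [show B - 1 + (((x - B + 1).toNat : ℕ) : ℤ) = x by omega] at this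

/-- For `A ≥ 0` the pairing was already evaluated; otherwise `p < 1/2` makes the decay rate `p / (1
- p)` smaller than `1`, which beats polynomial growth. -/
lemma IsContour.summable_ratInt (hγ : IsContour p γ) (hp₀ : 0 < p) (hp₁ : p < 1) {A : ℤ}
    (hA : p < 1 / 2 ∨ 0 ≤ A) (B e : ℤ) (C : ℕ) (α β : ℤ) :
    Summable fun x : ℤ => ratInt p γ A (B - x - 1) C * ratCoeff p α (x + β) e := by
  rcases le_or_gt 0 A with h | h
  · lift A to ℕ using h
    exact (hγ.hasSum_ratInt_of_nonneg hp₀.ne' A B e C α β).summable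
  · replace hA : p < 1 / 2 := hA.resolve_right (by omega)
    have h1 : p / (1 - p) < 1 := by
      rw [div_lt_one (by linarith)]
      linarith
    obtain ⟨θ, hθ, hθ₁⟩ := exists_between h1
    have hθ₀ : 0 < θ := lt_trans (div_pos hp₀ (by linarith)) hθ
    obtain ⟨k, rfl⟩ : ∃ k : ℕ, A = -(k : ℤ) := ⟨A.natAbs, by omega⟩
    obtain ⟨K, hK⟩ := hγ.norm_ratInt_neg_le hp₀ hp₁ hθ k B C
    refine summable_mul_of_mem_polyLT hθ₀ hθ₁ (B := B) ?_ hK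
      (ratCoeff_mem_polyLT p α β e (n := (e + 1).toNat) (by omega))
    intro x hx
    exact hγ.ratInt_eq_zero hp₀.ne' (by omega) (by omega)

end

/-! ### The dual functions -/

/-- The values of the pairing of the functions `Psi` with the polynomials `dualPoly`. -/
def pairCoeff (p : ℝ) (c : ℤ) (y : ℕ → ℤ) (r k : ℕ) : ℂ :=
  ratCoeff p (c + k) (y k + k) ((k : ℤ) - r)

/-- A basis of the polynomials of degree less than `n`, independent of the initial positions. -/
def dualPoly (p : ℝ) (c : ℤ) (n t r : ℕ) (x : ℤ) : ℂ :=
  ratCoeff p (c - t + n) (x + n) ((n : ℤ) - r)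

/-- `Φ` is the family dual to the functions `Psi`, for the pairing with values `pairCoeff`; this
makes sense also if the sums defining the pairing diverge. -/
def IsDual (p : ℝ) (c : ℤ) (y : ℕ → ℤ) (n t : ℕ) (Φ : ℕ → ℤ → ℂ) : Prop :=
  ∀ r ∈ Finset.Icc 1 n, ∀ x,
    ∑ k ∈ Finset.Icc 1 n, pairCoeff p c y r k * Φ k x = dualPoly p c n t r x

lemma pairCoeff_of_lt (p : ℝ) (c : ℤ) (y : ℕ → ℤ) {r k : ℕ} (h : k < r) :
    pairCoeff p c y r k = 0 := ratCoeff_of_neg _ _ _ (by omega)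

lemma pairCoeff_self (p : ℝ) (c : ℤ) (y : ℕ → ℤ) (k : ℕ) : pairCoeff p c y k k = 1 := by
  rw [pairCoeff, sub_self, ratCoeff_zero]

lemma dualPoly_of_lt (p : ℝ) (c : ℤ) (x : ℤ) {n r : ℕ} (t : ℕ) (h : n < r) :
    dualPoly p c n t r x = 0 := ratCoeff_of_neg _ _ _ (by omega)

/-- The matrix of `pairCoeff`. -/
def pairMatrix (p : ℝ) (c : ℤ) (y : ℕ → ℤ) (n : ℕ) :
    Matrix (Finset.Icc 1 n) (Finset.Icc 1 n) ℂ :=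
  Matrix.of fun r k => pairCoeff p c y r k

lemma det_pairMatrix (p : ℝ) (c : ℤ) (y : ℕ → ℤ) (n : ℕ) : (pairMatrix p c y n).det = 1 := by
  rw [Matrix.det_of_isUpperTriangular]
  · exact Finset.prod_eq_one fun k _ => pairCoeff_self p c y k
  · intro r k h
    exact pairCoeff_of_lt p c y h

lemma isUnit_det_pairMatrix (p : ℝ) (c : ℤ) (y : ℕ → ℤ) (n : ℕ) :
    IsUnit (pairMatrix p c y n).det := by
  rw [det_pairMatrix]; exact isUnit_one

/-- The family dual to the functions `Psi`. -/
def dualFun (p : ℝ) (c : ℤ) (y : ℕ → ℤ) (n t k : ℕ) (x : ℤ) : ℂ :=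
  if h : k ∈ Finset.Icc 1 n then
    ∑ r : Finset.Icc 1 n, (pairMatrix p c y n)⁻¹ ⟨k, h⟩ r * dualPoly p c n t r x
  else 0

lemma isDual_dualFun (p : ℝ) (c : ℤ) (y : ℕ → ℤ) (n t : ℕ) :
    IsDual p c y n t (dualFun p c y n t) := by
  intro r hr x
  have h := Matrix.mul_nonsing_inv _ (isUnit_det_pairMatrix p c y n)
  have h2 : (pairMatrix p c y n).mulVec ((pairMatrix p c y n)⁻¹.mulVec
      fun r => dualPoly p c n t r x) ⟨r, hr⟩ = dualPoly p c n t r x := by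
    rw [Matrix.mulVec_mulVec, h, Matrix.one_mulVec]
  rw [← h2, ← Finset.sum_coe_sort]
  refine Finset.sum_congr rfl fun k _ => ?_
  rw [dualFun, dif_pos k.2]
  rfl

section

variable {p : ℝ} {γ : ℝ → ℂ}

lemma IsContour.Psi_eq' (hγ : IsContour p γ) (hp : p ≠ 0) (y : ℕ → ℤ) {n t l : ℕ} (hl : l ≤ n)
    (x : ℤ) : Psi p γ y n t l x =
      ratInt p γ ((t : ℤ) - n + l) (y l - n + l - x - 1) ((n - l : ℕ) : ℤ) := by
  rw [hγ.Psi_eq hp, Nat.cast_sub hl]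
  congr 1
  ring

/-- In the pairing the exponents add up, and `n` and `t` cancel: all levels share one Gram matrix.
-/
lemma IsContour.hasSum_Psi_mul_dualPoly (hγ : IsContour p γ) (hp : p ≠ 0) (y : ℕ → ℤ)
    {n t l r : ℕ} (hl : l ∈ Finset.Icc 1 n) (c : ℤ)
    (hs : ∀ α β : ℤ, Summable fun x : ℤ =>
      Psi p γ y n t l x * ratCoeff p α (x + β) ((n : ℤ) - r)) :
    HasSum (fun x : ℤ => Psi p γ y n t l x * dualPoly p c n t r x) (pairCoeff p c y r l) := by
  have hln := (Finset.mem_Icc.1 hl).2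
  simp only [hγ.Psi_eq' hp y hln] at hs ⊢
  have := hγ.hasSum_ratInt hp _ _ _ _ hs (c - t + n) n
  unfold pairCoeff dualPoly
  convert this using 2
  · ring
  · ring
  · rw [Nat.cast_sub hln]
    ring

lemma IsContour.summable_Psi_mul (hγ : IsContour p γ) (hp₀ : 0 < p) (hp₁ : p < 1) (y : ℕ → ℤ)
    {n t l : ℕ} (h : p < 1 / 2 ∨ n ≤ t + 1) (hl : l ∈ Finset.Icc 1 n) (α β e : ℤ) :
    Summable fun x : ℤ => Psi p γ y n t l x * ratCoeff p α (x + β) e := by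
  have hln := Finset.mem_Icc.1 hl
  simp only [hγ.Psi_eq' hp₀.ne' y hln.2]
  exact hγ.summable_ratInt hp₀ hp₁ (h.imp_right fun h => by omega) _ _ _ _ _

end

lemma hasSum_mul_sum {ι : Type*} {s : Finset ι} {f : ℤ → ℂ} {g : ι → ℤ → ℂ} {v b : ι → ℂ}
    (h : ∀ i ∈ s, HasSum (fun x => f x * g i x) (v i)) :
    HasSum (fun x => f x * ∑ i ∈ s, b i * g i x) (∑ i ∈ s, b i * v i) := by
  have := hasSum_sum fun i hi => (h i hi).mul_left (b i)
  refine this.congr_fun fun x => ?_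
  rw [Finset.mul_sum]
  exact Finset.sum_congr rfl fun i _ => by ring

/-! ### Uniqueness and existence of the biorthogonal functions -/

namespace IsBiorthogonal

variable {p : ℝ} {γ : ℝ → ℂ} {y : ℕ → ℤ} {n t : ℕ} {Φ Φ' : ℕ → ℤ → ℂ}

lemma exists_coeff (h : IsBiorthogonal p γ y n t Φ) {g : ℤ → ℂ} (hg : g ∈ polyLT n) :
    ∃ b : ℕ → ℂ, (∀ x, g x = ∑ k ∈ Finset.Icc 1 n, b k * Φ k x) ∧
      ∀ l ∈ Finset.Icc 1 n, HasSum (fun x => Psi p γ y n t l x * g x) (b l) := by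
  rw [polyLT, ← h.span, Submodule.mem_span_image_finset_iff_exists_fun] at hg
  obtain ⟨b₀, hb⟩ := hg
  set b : ℕ → ℂ := fun k => if h : k ∈ Finset.Icc 1 n then b₀ ⟨k, h⟩ else 0 with hbdef
  have hb' : ∀ x, g x = ∑ k ∈ Finset.Icc 1 n, b k * Φ k x := fun x => by
    rw [← hb, Finset.sum_apply, ← Finset.sum_coe_sort (Finset.Icc 1 n) fun k => b k * Φ k x]
    refine Finset.sum_congr rfl fun k _ => ?_
    simp only [hbdef, dif_pos k.2]
    rfl
  refine ⟨b, hb', fun l hl => ?_⟩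
  simp only [hb']
  convert hasSum_mul_sum (b := b) fun k hk => h.ortho k hk l hl using 1
  simp [hl]

lemma mem_polyLT (h : IsBiorthogonal p γ y n t Φ) {k : ℕ} (hk : k ∈ Finset.Icc 1 n) :
    Φ k ∈ polyLT n := by
  rw [polyLT, ← h.span]
  exact Submodule.subset_span ⟨k, hk, rfl⟩

lemma eq (h : IsBiorthogonal p γ y n t Φ) (h' : IsBiorthogonal p γ y n t Φ') {k : ℕ}
    (hk : k ∈ Finset.Icc 1 n) : Φ k = Φ' k := by
  obtain ⟨b, hb, hb'⟩ := h'.exists_coeff (h.mem_polyLT hk)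
  ext x
  rw [hb, Finset.sum_eq_single_of_mem k hk]
  · rw [← (h.ortho k hk k hk).unique (hb' k hk), if_pos rfl, one_mul]
  · intro l hl hlk
    rw [← (h.ortho k hk l hl).unique (hb' l hl), if_neg hlk.symm, zero_mul]

/-- Expand `dualPoly` in the basis `Φ`: the coefficients are its pairings with `Psi`. Convergence
against every polynomial of degree less than `n` is inherited from `Φ` through the span condition.
-/
lemma isDual (h : IsBiorthogonal p γ y n t Φ) (hγ : IsContour p γ) (hp : p ≠ 0) (c : ℤ) :
    IsDual p c y n t Φ := by
  intro r hr x
  have hr' := Finset.mem_Icc.1 hr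
  obtain ⟨b, hb, hb'⟩ := h.exists_coeff (g := dualPoly p c n t r)
    (ratCoeff_mem_polyLT p _ _ _ (by omega))
  rw [hb]
  refine Finset.sum_congr rfl fun l hl => ?_
  rw [(hb' l hl).unique (hγ.hasSum_Psi_mul_dualPoly hp y hl c fun α β => ?_)]
  obtain ⟨_, _, h2⟩ := h.exists_coeff (ratCoeff_mem_polyLT p α β ((n : ℤ) - r) (by omega))
  exact (h2 l hl).summable

end IsBiorthogonal

/-- Existence of the biorthogonal functions if the sums converge. -/
lemma IsContour.exists_isBiorthogonal {p : ℝ} {γ : ℝ → ℂ} (hγ : IsContour p γ) (hp₀ : 0 < p)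
    (hp₁ : p < 1) (y : ℕ → ℤ) {n t : ℕ} (h : p < 1 / 2 ∨ n ≤ t + 1) :
    ∃ Φ, IsBiorthogonal p γ y n t Φ := by
  -- With this `c` the factor `1 + p z` drops out of `dualPoly`, leaving plain binomial
  -- coefficients, whose span is known.
  set c : ℤ := (t : ℤ) - n with hc
  set D := pairMatrix p c y n with hD
  refine ⟨dualFun p c y n t, fun k hk l hl => ?_, ?_⟩
  · have h1 := hasSum_mul_sum (s := Finset.univ) (g := fun r : Finset.Icc 1 n => dualPoly p c n t r)
      (b := fun r => D⁻¹ ⟨k, hk⟩ r)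
      fun r _ => hγ.hasSum_Psi_mul_dualPoly hp₀.ne' y hl c
        fun α β => hγ.summable_Psi_mul hp₀ hp₁ y h hl α β _
    have h2 : ∑ r, D⁻¹ ⟨k, hk⟩ r * pairCoeff p c y r l = if k = l then 1 else 0 := by
      have := congrFun₂ (Matrix.nonsing_inv_mul _ (isUnit_det_pairMatrix p c y n)) ⟨k, hk⟩ ⟨l, hl⟩
      rw [Matrix.mul_apply, Matrix.one_apply] at this
      simp only [Subtype.mk.injEq] at this
      exact this
    rw [h2] at h1
    refine h1.congr_fun fun x => ?_
    rw [dualFun, dif_pos hk]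
  · have hspan : Submodule.span ℂ (dualPoly p c n t '' (Finset.Icc 1 n : Set ℕ)) = polyLT n := by
      rw [← span_ratCoeff_zero_left p n]
      congr 1
      ext f
      constructor
      · rintro ⟨r, hr, rfl⟩
        simp only [Finset.coe_Icc, Set.mem_Icc] at hr
        refine ⟨n - r, by simp only [Finset.coe_range, Set.mem_Iio]; omega, ?_⟩
        ext x
        simp only [dualPoly, hc]
        congr 1
        · ring
        · omega
      · rintro ⟨r, hr, rfl⟩
        simp only [Finset.coe_range, Set.mem_Iio] at hr
        refine ⟨n - r, by simp only [Finset.coe_Icc, Set.mem_Icc]; omega, ?_⟩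
        ext x
        simp only [dualPoly, hc]
        congr 1
        · ring
        · omega
    change _ = polyLT n
    rw [← hspan]
    apply le_antisymm
    · refine Submodule.span_le.2 ?_
      rintro _ ⟨k, hk, rfl⟩
      have : dualFun p c y n t k = ∑ r : Finset.Icc 1 n, D⁻¹ ⟨k, hk⟩ r • dualPoly p c n t r := by
        ext x
        have hk' : k ∈ Finset.Icc 1 n := hk
        rw [dualFun, dif_pos hk', Finset.sum_apply]
        rfl
      rw [SetLike.mem_coe, this]
      exact Submodule.sum_mem _ fun r _ =>
        Submodule.smul_mem _ _ (Submodule.subset_span ⟨r, r.2, rfl⟩)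
    · refine Submodule.span_le.2 ?_
      rintro _ ⟨r, hr, rfl⟩
      have : dualPoly p c n t r =
          ∑ k ∈ Finset.Icc 1 n, pairCoeff p c y r k • dualFun p c y n t k := by
        ext x
        rw [← isDual_dualFun p c y n t r hr x, Finset.sum_apply]
        rfl
      rw [SetLike.mem_coe, this]
      exact Submodule.sum_mem _ fun k hk =>
        Submodule.smul_mem _ _ (Submodule.subset_span ⟨k, hk, rfl⟩)

/-! ### The kernel to the left of all particles -/

/-- The positions `y 1 > y 2 > … > y M`. -/
def StrictDecr (M : ℕ) (y : ℕ → ℤ) : Prop := ∀ k, 1 ≤ k → k < M → y (k + 1) < y k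

lemma StrictDecr.add_le {M : ℕ} {y : ℕ → ℤ} (hy : StrictDecr M y) {k n : ℕ} (hk : 1 ≤ k)
    (hkn : k ≤ n) (hn : n ≤ M) : y n + n ≤ y k + k := by
  induction n, hkn using Nat.le_induction with
  | base => exact le_rfl
  | succ n hkn ih =>
    have := hy n (by omega) (by omega)
    have := ih (by omega)
    push_cast
    omega

lemma Prec.trans {P Q R : ℕ × ℕ} (h : Prec P Q) (h' : Prec Q R) : Prec P R := by
  obtain ⟨h1, h2, h3⟩ := h
  obtain ⟨h4, h5, h6⟩ := h'
  refine ⟨h1.trans h4, h5.trans h2, ?_⟩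
  rintro rfl
  exact h3 (Prod.ext (by omega) (by omega))

lemma Prec.not_symm {P Q : ℕ × ℕ} (h : Prec P Q) : ¬ Prec Q P := fun h' => (h.trans h').2.2 rfl

lemma IsSpaceLike.prec {m : ℕ} {n t : Fin m → ℕ} (h : IsSpaceLike n t) {i j : Fin m} (hij : i < j) :
    Prec (n i, t i) (n j, t j) := by
  obtain ⟨j, hj⟩ := j
  have hij' : (i : ℕ) + 1 ≤ j := hij
  clear hij
  induction j, hij' using Nat.le_induction with
  | base => exact h i ⟨(i : ℕ) + 1, hj⟩ rfl
  | succ j hij ih => exact (ih (by omega)).trans (h ⟨j, by omega⟩ ⟨j + 1, hj⟩ rfl)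

section

variable {p : ℝ} {γ : ℝ → ℂ} {y : ℕ → ℤ} {M : ℕ}

/-- To the left of `y n` the exponents of `w` and of `1 + w` are both nonnegative, so the integrand
has no pole inside the contour. -/
lemma IsContour.Psi_eq_zero (hγ : IsContour p γ) (hp : p ≠ 0) (hy : StrictDecr M y) {n k : ℕ}
    (t : ℕ) (hk : k ∈ Finset.Icc 1 n) (hn : n ≤ M) {x : ℤ} (hx : x < y n) :
    Psi p γ y n t k x = 0 := by
  rw [Finset.mem_Icc] at hk
  have := hy.add_le hk.1 hk.2 hn
  rw [hγ.Psi_eq hp, hγ.ratInt_eq_zero hp (by omega) (by omega)]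

lemma IsContour.Psi_eq_ratCoeff (hγ : IsContour p γ) (hp : p ≠ 0) (hy : StrictDecr M y)
    {n n' k : ℕ} (t : ℕ) (hk : k ∈ Finset.Icc 1 n') (hn : n ≤ n') (hn' : n' ≤ M) {x : ℤ}
    (hx : x < y n') : Psi p γ y n t k x =
      ratCoeff p ((t : ℤ) - n + k) (y k - x - 1 - n + k) ((k : ℤ) - n - 1) := by
  rw [Finset.mem_Icc] at hk
  have := hy.add_le hk.1 hk.2 hn'
  rw [hγ.Psi_eq hp, hγ.ratInt_eq_ratCoeff hp _ _ _ (by omega)]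
  congr 1
  ring

variable {m : ℕ} {n t : Fin m → ℕ} {Φ : Fin m → ℕ → ℤ → ℂ}

lemma IsContour.extKernel_eq_zero_of_not_prec (hγ : IsContour p γ) (hp : p ≠ 0)
    (hy : StrictDecr M y) {P Q : Fin m × ℤ} (hP : n P.1 ≤ M) (hnn : n Q.1 ≤ n P.1)
    (hPQ : ¬ Prec (n P.1, t P.1) (n Q.1, t Q.1)) (hx : P.2 < y (n P.1)) :
    extKernel p γ y n t Φ P Q = 0 := by
  rw [extKernel, phiStar, if_neg hPQ, neg_zero, zero_add]
  refine Finset.sum_eq_zero fun k hk => ?_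
  rw [hγ.Psi_eq_zero hp hy _ (Finset.Icc_subset_Icc_right hnn hk) hP hx, zero_mul]

/-- Here `Psi` has no pole at `-1`, so it factors through `pairCoeff` by a Cauchy product. Duality
replaces the sum over `k` by `dualPoly`, and a second Cauchy product yields exactly `phiStar`; `P.2
< Q.2` ensures that `phiStar`, too, is a residue at `0`. -/
lemma IsContour.extKernel_eq_zero_of_prec (hγ : IsContour p γ) (hp : p ≠ 0)
    (hy : StrictDecr M y) {P Q : Fin m × ℤ} (hQ : n Q.1 ≤ M) {c : ℤ}
    (hPQ : Prec (n P.1, t P.1) (n Q.1, t Q.1)) (hΦ : IsDual p c y (n Q.1) (t Q.1) (Φ Q.1))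
    (hx : P.2 < y (n Q.1)) (hxx : P.2 < Q.2) : extKernel p γ y n t Φ P Q = 0 := by
  have hnn : n P.1 ≤ n Q.1 := hPQ.1
  set s := n P.1 with hs
  set N := n Q.1 with hN
  have h1 : ∀ k ∈ Finset.Icc 1 N, Psi p γ y s (t P.1) k P.2 = ∑ r ∈ Finset.Icc 1 N,
      ratCoeff p ((t P.1 : ℤ) - s - c) (-P.2 - 1 - s) ((r : ℤ) - s - 1) *
        pairCoeff p c y r k := by
    intro k hk
    rw [hγ.Psi_eq_ratCoeff hp hy (t P.1) hk hnn hQ hx]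
    simp only [pairCoeff]
    rw [sum_ratCoeff_mul _ _ _ _ _ _ _ _ (Finset.mem_Icc.1 hk).2]
    congr 1 <;> ring
  have h2 : ∑ k ∈ Finset.Icc 1 N, Psi p γ y s (t P.1) k P.2 * Φ Q.1 k Q.2 =
      ∑ r ∈ Finset.Icc 1 N, ratCoeff p ((t P.1 : ℤ) - s - c) (-P.2 - 1 - s) ((r : ℤ) - s - 1) *
        dualPoly p c N (t Q.1) r Q.2 := by
    rw [Finset.sum_congr rfl fun k hk => by rw [h1 k hk, Finset.sum_mul], Finset.sum_comm]
    refine Finset.sum_congr rfl fun r hr => ?_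
    rw [← hΦ r hr, Finset.mul_sum]
    exact Finset.sum_congr rfl fun k _ => mul_assoc _ _ _
  rw [extKernel, h2]
  simp only [dualPoly]
  rw [sum_ratCoeff_mul _ _ _ _ _ _ _ _ le_rfl, hγ.phiStar_eq hp hPQ,
    hγ.ratInt_eq_ratCoeff hp _ _ _ (by simp only; omega), neg_add_eq_zero]
  simp only
  congr 1 <;> ring

end

/-! ### Fredholm determinants with finite support -/

/-- Tuples with a repetition give zero; each subset of size `r` has `r!` enumerations, all with the
same principal minor. -/
lemma sum_det_submatrix {κ : Type*} [Fintype κ] [DecidableEq κ] (A : Matrix κ κ ℂ) (r : ℕ) :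
    ∑ z : Fin r → κ, (A.submatrix z z).det = (r.factorial : ℂ) *
      ∑ s ∈ Finset.univ.powersetCard r,
        (A.submatrix (Subtype.val : s → κ) (Subtype.val : s → κ)).det := by
  classical
  have h1 : ∀ z : Fin r → κ, ¬ Function.Injective z → (A.submatrix z z).det = 0 := by
    intro z hz
    simp only [Function.Injective, not_forall] at hz
    obtain ⟨i, j, hij, hne⟩ := hz
    exact Matrix.det_zero_of_row_eq hne (by ext k; simp [hij])
  rw [← Finset.sum_filter_add_sum_filter_not _ Function.Injective,
    Finset.sum_eq_zero (s := Finset.univ.filter fun z : Fin r → κ => ¬ Function.Injective z)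
      fun z hz => h1 z (Finset.mem_filter.1 hz).2, add_zero, Finset.mul_sum]
  have hmaps : ∀ z ∈ Finset.univ.filter fun z : Fin r → κ => Function.Injective z,
      Finset.univ.image z ∈ (Finset.univ : Finset κ).powersetCard r := by
    intro z hz
    rw [Finset.mem_powersetCard]
    exact ⟨Finset.subset_univ _, by
      rw [Finset.card_image_of_injective _ (Finset.mem_filter.1 hz).2, Finset.card_fin]⟩
  rw [← Finset.sum_fiberwise_of_maps_to hmaps]
  refine Finset.sum_congr rfl fun s hs => ?_
  have hcard := (Finset.mem_powersetCard.1 hs).2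
  let e : Fin r ≃ s := (Finset.equivFinOfCardEq hcard).symm
  have hbij : ((Finset.univ.filter fun z : Fin r → κ => Function.Injective z).filter
      fun z => Finset.univ.image z = s) =
      Finset.univ.image fun σ : Equiv.Perm (Fin r) => fun i => (e (σ i) : κ) := by
    ext z
    simp only [Finset.mem_filter, Finset.mem_univ, true_and, Finset.mem_image]
    constructor
    · rintro ⟨hz, hzs⟩
      have hmem : ∀ i, z i ∈ s := fun i => by
        rw [← hzs]; exact Finset.mem_image_of_mem _ (Finset.mem_univ _)
      have hinj : Function.Injective fun i => e.symm ⟨z i, hmem i⟩ := fun i j hij => by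
        have := e.symm.injective hij
        exact hz (congrArg Subtype.val this)
      refine ⟨Equiv.ofBijective _ (Finite.injective_iff_bijective.1 hinj), ?_⟩
      ext i
      simp
    · rintro ⟨σ, rfl⟩
      refine ⟨fun i j hij => σ.injective (e.injective (Subtype.ext hij)), ?_⟩
      ext x
      simp only [Finset.mem_image, Finset.mem_univ, true_and]
      constructor
      · rintro ⟨i, rfl⟩
        exact (e (σ i)).2
      · intro hx
        exact ⟨σ.symm (e.symm ⟨x, hx⟩), by simp⟩
  rw [hbij, Finset.sum_image]
  · have h2 : ∀ σ : Equiv.Perm (Fin r),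
        (A.submatrix (fun i => (e (σ i) : κ)) fun i => (e (σ i) : κ)).det =
          (A.submatrix (Subtype.val : s → κ) (Subtype.val : s → κ)).det := fun σ => by
      rw [← Matrix.det_submatrix_equiv_self (σ.trans e)]
      rfl
    rw [Finset.sum_congr rfl fun σ _ => h2 σ, Finset.sum_const, Finset.card_univ,
      Fintype.card_perm, Fintype.card_fin, nsmul_eq_mul]
  · intro σ _ τ _ h
    ext i
    have := e.injective (Subtype.ext (congrFun h i))
    rw [this]

lemma det_one_sub_eq_sum {κ : Type*} [Fintype κ] [DecidableEq κ] (A : Matrix κ κ ℂ) :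
    (1 - A).det = ∑ r ∈ Finset.range (Fintype.card κ + 1),
      (-1) ^ r / (r.factorial : ℂ) * ∑ z : Fin r → κ, (A.submatrix z z).det := by
  have h := Polynomial.eval_eq_sum_range' (n := Fintype.card κ + 1)
    (p := (1 + (Polynomial.X : Polynomial ℂ) • (-A).map Polynomial.C).det) (by
      refine Nat.lt_succ_of_le ?_
      rw [add_comm, show (1 : Matrix κ κ (Polynomial ℂ)) = (1 : Matrix κ κ ℂ).map Polynomial.C by
        simp]
      exact Polynomial.natDegree_det_X_add_C_le _ _) 1
  have h2 : Polynomial.eval 1 (1 + (Polynomial.X : Polynomial ℂ) • (-A).map Polynomial.C).det =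
      (1 - A).det := by
    rw [← Polynomial.coe_evalRingHom, RingHom.map_det]
    congr 1
    ext i j
    by_cases hij : i = j <;> simp [hij, sub_eq_add_neg]
  rw [← h2, h]
  refine Finset.sum_congr rfl fun r _ => ?_
  have hr : (r.factorial : ℂ) ≠ 0 := by exact_mod_cast r.factorial_ne_zero
  rw [Matrix.coeff_det_one_add_X_smul_eq_sum_minors, sum_det_submatrix, one_pow, mul_one,
    ← mul_assoc, div_mul_cancel₀ _ hr, Finset.mul_sum]
  refine Finset.sum_congr rfl fun s hs => ?_
  rw [Matrix.submatrix_neg, Pi.neg_apply, Pi.neg_apply, Matrix.det_neg, Fintype.card_coe,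
    (Finset.mem_powersetCard.1 hs).2]

lemma det_eq_zero_of_not_injective {ι : Type*} (K : ι → ι → ℂ) {r : ℕ} {z : Fin r → ι}
    (hz : ¬ Function.Injective z) : (Matrix.of fun i j => K (z i) (z j)).det = 0 := by
  simp only [Function.Injective, not_forall] at hz
  obtain ⟨i, j, hij, hne⟩ := hz
  exact Matrix.det_zero_of_row_eq hne (by ext k; simp [hij])

/-- If all minors that leave the finite set `range e` vanish, then the Fredholm determinant is a
finite determinant. -/
lemma hasFredholmDet_of_range {ι κ : Type*} [Fintype κ] [DecidableEq κ] (K : ι → ι → ℂ)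
    (e : κ → ι) (he : Function.Injective e)
    (h : ∀ (r : ℕ) (z : Fin r → ι), (∃ i, z i ∉ Set.range e) →
      (Matrix.of fun i j => K (z i) (z j)).det = 0) :
    HasFredholmDet K (1 - Matrix.of fun a b => K (e a) (e b)).det := by
  set g : ((r : ℕ) × (Fin r → κ)) → (r : ℕ) × (Fin r → ι) :=
    Sigma.map id fun _ z => e ∘ z with hg
  have hginj : Function.Injective g :=
    Function.injective_id.sigma_map fun r => he.comp_left
  rw [HasFredholmDet, ← hginj.hasSum_iff]
  · rw [det_one_sub_eq_sum]
    have := hasSum_sum_of_ne_finset_zero (L := SummationFilter.unconditional _)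
      (s := (Finset.range (Fintype.card κ + 1)).sigma fun r =>
        (Finset.univ : Finset (Fin r → κ)))
      (f := (fun z : (r : ℕ) × (Fin r → ι) => (-1) ^ z.1 / (z.1.factorial : ℂ) *
        (Matrix.of fun i j => K (z.2 i) (z.2 j)).det) ∘ g) ?_
    · rw [Finset.sum_sigma] at this
      convert this using 2 with r
      rw [Finset.mul_sum]
      rfl
    · rintro ⟨r, z⟩ hz
      -- More rows than points in `κ` force two equal rows.
      have hr : Fintype.card κ < r := by
        by_contra hr
        exact hz (by simp; omega)
      have hz' : ¬ Function.Injective fun i => e (z i) := fun hinj => by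
        have := Fintype.card_le_of_injective z fun i j hij => hinj (by simp [hij])
        rw [Fintype.card_fin] at this
        omega
      have := det_eq_zero_of_not_injective K hz'
      change (-1) ^ r / (r.factorial : ℂ) * (Matrix.of fun i j => K (e (z i)) (e (z j))).det = 0
      rw [this, mul_zero]
  · rintro ⟨r, z⟩ hz
    have : ∃ i, z i ∉ Set.range e := by
      by_contra! hc
      choose w hw using hc
      exact hz ⟨⟨r, w⟩, by simp only [hg, Sigma.map, id]; congr 1; ext i; exact hw i⟩
    simp only
    rw [h r z this, mul_zero]

/-! ### Reduction to a finite window -/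

/-- The window `{L, …, A - 1}` at all levels. -/
abbrev Window (m : ℕ) (L A : ℤ) : Type := Fin m × Finset.Ico L A

lemma IsContour.hasFredholmDet_extKernel {p : ℝ} {γ : ℝ → ℂ} (hγ : IsContour p γ) (hp : p ≠ 0)
    {y : ℕ → ℤ} {M : ℕ} (hy : StrictDecr M y) {m : ℕ} {n t : Fin m → ℕ} (hS : IsSpaceLike n t)
    (hn : ∀ i, n i ≤ M) {Φ : Fin m → ℕ → ℤ → ℂ} {c : ℤ}
    (hΦ : ∀ i, IsDual p c y (n i) (t i) (Φ i)) {a : Fin m → ℤ} {L A : ℤ}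
    (hL : ∀ i, L ≤ y (n i)) (hA : ∀ i, a i ≤ A) :
    HasFredholmDet (fun P Q => chi a P * extKernel p γ y n t Φ P Q * chi a Q)
      (1 - Matrix.of fun P Q : Window m L A =>
        chi a (P.1, (P.2 : ℤ)) * extKernel p γ y n t Φ (P.1, (P.2 : ℤ)) (Q.1, (Q.2 : ℤ)) *
          chi a (Q.1, (Q.2 : ℤ))).det := by
  refine hasFredholmDet_of_range _ (fun P : Window m L A => (P.1, (P.2 : ℤ))) ?_ ?_
  · rintro ⟨i, x⟩ ⟨j, x'⟩ h
    simp only [Prod.mk.injEq] at h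
    exact Prod.ext h.1 (Subtype.ext h.2)
  · rintro r z ⟨i, hi⟩
    by_contra hdet
    rw [Matrix.det_apply] at hdet
    obtain ⟨σ, -, hσ⟩ := Finset.exists_ne_zero_of_sum_ne_zero hdet
    have hprod : ∀ k, chi a (z k) * extKernel p γ y n t Φ (z k) (z (σ.symm k)) *
        chi a (z (σ.symm k)) ≠ 0 := by
      intro k hk
      apply hσ
      rw [Finset.prod_eq_zero (Finset.mem_univ (σ.symm k)), smul_zero]
      simpa using hk
    -- In a nonzero term of the Leibniz expansion, a point to the left of `L` can only be followed
    -- by another such point on a strictly later level. A point of maximal level among them then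
    -- gives a contradiction.
    have hstep : ∀ k, (z k).2 < L → (z k).1 < (z (σ.symm k)).1 ∧ (z (σ.symm k)).2 < L := by
      intro k hk
      have hK : extKernel p γ y n t Φ (z k) (z (σ.symm k)) ≠ 0 := fun h0 =>
        hprod k (by rw [h0]; ring)
      rcases lt_or_ge (z k).1 (z (σ.symm k)).1 with hlt | hge
      · refine ⟨hlt, ?_⟩
        by_contra hge
        exact hK (hγ.extKernel_eq_zero_of_prec hp hy (hn _) (hS.prec hlt) (hΦ _)
          (hk.trans_le (hL _)) (by omega))
      · exfalso
        refine hK (hγ.extKernel_eq_zero_of_not_prec hp hy (hn _) ?_ ?_ (hk.trans_le (hL _)))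
        · rcases hge.eq_or_lt with h | h
          · rw [h]
          · exact (hS.prec h).1
        · rcases hge.eq_or_lt with h | h
          · rw [h]
            exact fun h' => h'.2.2 rfl
          · exact (hS.prec h).not_symm
    have hall : ∀ k, L ≤ (z k).2 := by
      by_contra! hc
      obtain ⟨k, hk⟩ := hc
      obtain ⟨l, hl, hmax⟩ := Finset.exists_max_image
        (Finset.univ.filter fun k => (z k).2 < L) (fun k => (z k).1) ⟨k, by simpa using hk⟩
      have h1 := hstep l (by simpa using hl)
      exact absurd (hmax (σ.symm l) (by simpa using h1.2)) (not_le.2 h1.1)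
    refine hi ⟨((z i).1, ⟨(z i).2, ?_⟩), rfl⟩
    rw [Finset.mem_Ico]
    refine ⟨hall i, ?_⟩
    by_contra hge
    refine hprod i ?_
    rw [chi, if_neg (by have := hA (z i).1; omega), zero_mul, zero_mul]

/-! ### The determinant with an independent column for each particle -/

/-- The cut-off `chi`, restricted to the levels in `S`. -/
def chiOn {m : ℕ} (S : Finset (Fin m)) (a : Fin m → ℤ) (P : Fin m × ℤ) : ℂ :=
  if P.1 ∈ S ∧ P.2 < a P.1 then 1 else 0

lemma chiOn_of_notMem {m : ℕ} {S : Finset (Fin m)} (a : Fin m → ℤ) {P : Fin m × ℤ}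
    (h : P.1 ∉ S) : chiOn S a P = 0 := if_neg fun h' => h h'.1

section

variable (p : ℝ) (γ : ℝ → ℂ) (y : ℕ → ℤ) {m : ℕ} (n t : Fin m → ℕ) (S : Finset (Fin m))
  (a : Fin m → ℤ) (L A : ℤ)

/-- The cut-off kernel on a window, for the levels in `S`. -/
def windowKernel (Φ : Fin m → ℕ → ℤ → ℂ) : Matrix (Window m L A) (Window m L A) ℂ :=
  Matrix.of fun P Q => chiOn S a (P.1, (P.2 : ℤ)) *
    extKernel p γ y n t Φ (P.1, (P.2 : ℤ)) (Q.1, (Q.2 : ℤ)) * chiOn S a (Q.1, (Q.2 : ℤ))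

/-- The cut-off polynomials. -/
def windowDual (c : ℤ) (N : ℕ) : Matrix (Finset.Icc 1 N) (Window m L A) ℂ :=
  Matrix.of fun r Q => dualPoly p c (n Q.1) (t Q.1) r Q.2 * chiOn S a (Q.1, (Q.2 : ℤ))

/-- The cut-off functions `Psi`. -/
def windowPsi (N : ℕ) : Matrix (Window m L A) (Finset.Icc 1 N) ℂ :=
  Matrix.of fun P k => chiOn S a (P.1, (P.2 : ℤ)) * Psi p γ y (n P.1) (t P.1) k P.2

/-- The cut-off functions `phiStar`. -/
def windowPhi : Matrix (Window m L A) (Window m L A) ℂ :=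
  Matrix.of fun P Q => chiOn S a (P.1, (P.2 : ℤ)) *
    phiStar p γ (n P.1, t P.1) (n Q.1, t Q.1) P.2 Q.2 * chiOn S a (Q.1, (Q.2 : ℤ))

/-- A matrix with determinant `det (1 - K)` in which the initial position of each particle
enters in one column only. -/
def blockKernel (c : ℤ) (N : ℕ) :
    Matrix (Finset.Icc 1 N ⊕ Window m L A) (Finset.Icc 1 N ⊕ Window m L A) ℂ :=
  Matrix.fromBlocks (pairMatrix p c y N) (windowDual p n t S a L A c N)
    (windowPsi p γ y n t S a L A N) (1 + windowPhi p γ n t S a L A)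

variable {p γ y n t S a L A}

/-- Schur complement with respect to `pairMatrix`, which has determinant `1`: duality reads
`windowDual = pairMatrix * F`, so the inverse never has to be computed. -/
lemma det_blockKernel {c : ℤ} {N : ℕ} {Φ : Fin m → ℕ → ℤ → ℂ} (hn : ∀ i ∈ S, n i ≤ N)
    (hΦ : ∀ i ∈ S, IsDual p c y (n i) (t i) (Φ i)) :
    (blockKernel p γ y n t S a L A c N).det =
      (1 - windowKernel p γ y n t S a L A Φ).det := by
  -- The functions `Φ` of all levels, extended by zero to the labels `n Q.1 < k ≤ N`. Triangularity
  -- of `pairCoeff` keeps the duality valid for the rows `r > n Q.1`.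
  set F : Matrix (Finset.Icc 1 N) (Window m L A) ℂ := Matrix.of fun k Q =>
    (if (k : ℕ) ≤ n Q.1 then Φ Q.1 k Q.2 else 0) * chiOn S a (Q.1, (Q.2 : ℤ)) with hF
  have hsum : ∀ (g : ℕ → ℂ) (Q : Window m L A), Q.1 ∈ S →
      ∑ k : Finset.Icc 1 N, g k * (if (k : ℕ) ≤ n Q.1 then Φ Q.1 k Q.2 else 0) =
        ∑ k ∈ Finset.Icc 1 (n Q.1), g k * Φ Q.1 k Q.2 := by
    intro g Q hQ
    rw [Finset.sum_coe_sort (Finset.Icc 1 N)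
      fun k => g k * (if k ≤ n Q.1 then Φ Q.1 k Q.2 else 0)]
    simp only [mul_ite, mul_zero]
    rw [← Finset.sum_filter]
    refine Finset.sum_congr ?_ fun _ _ => rfl
    ext k
    have := hn _ hQ
    simp only [Finset.mem_filter, Finset.mem_Icc]
    omega
  have hB : windowDual p n t S a L A c N = pairMatrix p c y N * F := by
    ext r Q
    by_cases hQ : Q.1 ∈ S
    · simp only [Matrix.mul_apply, hF, Matrix.of_apply, ← mul_assoc, ← Finset.sum_mul, pairMatrix,
        windowDual]
      congr 1
      rw [hsum (fun k => pairCoeff p c y r k) Q hQ]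
      by_cases hr : (r : ℕ) ≤ n Q.1
      · exact (hΦ _ hQ r (Finset.mem_Icc.2 ⟨(Finset.mem_Icc.1 r.2).1, hr⟩) _).symm
      · rw [dualPoly_of_lt _ _ _ _ (by omega), Finset.sum_eq_zero]
        intro k hk
        rw [pairCoeff_of_lt _ _ _ (by rw [Finset.mem_Icc] at hk; omega), zero_mul]
    · simp [Matrix.mul_apply, hF, windowDual, chiOn_of_notMem a (P := (Q.1, (Q.2 : ℤ))) hQ]
  have hK : 1 - windowKernel p γ y n t S a L A Φ =
      1 + windowPhi p γ n t S a L A - windowPsi p γ y n t S a L A N * F := by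
    ext P Q
    simp only [Matrix.sub_apply, Matrix.add_apply, Matrix.mul_apply, hF, Matrix.of_apply,
      windowKernel, windowPhi, windowPsi]
    by_cases hQ : Q.1 ∈ S
    · rw [extKernel, ← hsum (fun k => Psi p γ y (n P.1) (t P.1) k P.2) Q hQ]
      simp only [← mul_assoc, ← Finset.sum_mul]
      simp only [mul_assoc, ← Finset.mul_sum]
      ring
    · simp [chiOn_of_notMem a (P := (Q.1, (Q.2 : ℤ))) hQ]
  let _ := (pairMatrix p c y N).invertibleOfIsUnitDet (isUnit_det_pairMatrix p c y N)
  rw [blockKernel, Matrix.det_fromBlocks₁₁, det_pairMatrix, one_mul, hB, hK, Matrix.mul_assoc,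
    Matrix.invOf_mul_cancel_left]

end

/-! ### One time step -/

/-- The positions after one time step with attempts `b`. -/
def stepPos (b : ℕ → Bool) (y : ℕ → ℤ) (j : ℕ) : ℤ :=
  if b j = true ∧ (j = 1 ∨ y (j - 1) ≠ y j + 1) then y j + 1 else y j

lemma StrictDecr.stepPos {M : ℕ} {y : ℕ → ℤ} (hy : StrictDecr M y) (b : ℕ → Bool) :
    StrictDecr M (stepPos b y) := by
  intro k hk hkM
  have := hy k hk hkM
  unfold _root_.stepPos
  rw [add_tsub_cancel_right]
  split_ifs with h1 h2 h2 <;> omega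

lemma le_stepPos (b : ℕ → Bool) (y : ℕ → ℤ) (j : ℕ) : y j ≤ stepPos b y j := by
  unfold stepPos
  split_ifs <;> omega

/-- The weight of one attempt. -/
def attemptWeight (p : ℝ) (b : Bool) : ℝ := if b then p else 1 - p

/-- Extension of the attempts of the first `N` particles. -/
def extendAttempts {N : ℕ} (b : Finset.Icc 1 N → Bool) (j : ℕ) : Bool :=
  if h : j ∈ Finset.Icc 1 N then b ⟨j, h⟩ else false

open scoped Classical in
/-- The column operations describing the blocked particles. -/
def blockingMatrix (p : ℝ) (y : ℕ → ℤ) (N : ℕ) : Matrix (Finset.Icc 1 N) (Finset.Icc 1 N) ℂ :=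
  Matrix.of fun l k => (if l = k then 1 else 0) -
    if (l : ℕ) + 1 = k ∧ y l = y k + 1 then (p : ℂ) else 0

lemma det_blockingMatrix (p : ℝ) (y : ℕ → ℤ) (N : ℕ) : (blockingMatrix p y N).det = 1 := by
  rw [Matrix.det_of_isUpperTriangular]
  · exact Finset.prod_eq_one fun k _ => by simp [blockingMatrix]
  · intro l k h
    have h : (k : ℕ) < l := h
    have h1 : l ≠ k := fun h' => by rw [h'] at h; omega
    have h2 : ¬ ((l : ℕ) + 1 = k ∧ y l = y k + 1) := by omega
    simp [blockingMatrix, h1, h2]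

/-- One time step for a function `G₁ k (y k)` of the label and the position of a particle. -/
lemma sum_mul_blockingMatrix {p : ℝ} {G₀ G₁ : ℕ → ℤ → ℂ}
    (hfree : ∀ k Y, G₁ k Y = (1 - p) * G₀ k Y + p * G₀ k (Y + 1))
    (hblock : ∀ k Y, G₀ (k + 1) Y = G₁ (k + 1) Y - p * G₁ k (Y + 1))
    (y : ℕ → ℤ) {N : ℕ} (k : Finset.Icc 1 N) :
    ∑ l : Finset.Icc 1 N, G₁ l (y l) * blockingMatrix p y N l k =
      ∑ b : Bool, (attemptWeight p b : ℂ) * G₀ k (stepPos (fun _ => b) y k) := by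
  obtain ⟨k, hk⟩ := k
  simp only [blockingMatrix, Matrix.of_apply, mul_sub, Finset.sum_sub_distrib, mul_ite, mul_one,
    mul_zero, Finset.sum_ite_eq', Finset.mem_univ, if_true, Fintype.sum_bool, attemptWeight,
    stepPos, Bool.false_eq_true, false_and, if_false, true_and]
  rw [Finset.mem_Icc] at hk
  by_cases hb : k ≠ 1 ∧ y (k - 1) = y k + 1
  · rw [if_neg (by omega), Finset.sum_eq_single ⟨k - 1, Finset.mem_Icc.2 (by omega)⟩]
    · simp only
      rw [if_pos (by omega), hb.2]
      obtain ⟨k, rfl⟩ : ∃ k', k = k' + 1 := ⟨k - 1, by omega⟩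
      rw [add_tsub_cancel_right, hblock]
      push_cast
      ring
    · intro l _ hl
      rw [if_neg]
      rintro ⟨h, -⟩
      exact hl (Subtype.ext (by simp only; omega))
    · simp
  · rw [if_pos (by omega), Finset.sum_eq_zero, hfree]
    · push_cast
      ring
    · rintro ⟨l, hl⟩ -
      rw [if_neg]
      rintro ⟨h1, h2⟩
      simp only at h1 h2
      rw [Finset.mem_Icc] at hl
      subst h1
      exact hb ⟨by omega, by rw [add_tsub_cancel_right]; exact h2⟩

/-- Averaging over independent `b k` can be done column by column, since column `k` depends on `b k`
only. -/
lemma sum_prod_mul_det {α κ β : Type*} [Fintype α] [DecidableEq α] [Fintype κ] [DecidableEq κ]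
    [Fintype β] (w : β → ℂ) (A : β → Matrix α α ℂ) (B : Matrix α κ ℂ) (C : β → Matrix κ α ℂ)
    (D : Matrix κ κ ℂ) :
    ∑ b : α → β, (∏ k, w (b k)) *
        (Matrix.fromBlocks (Matrix.of fun r k => A (b k) r k) B
          (Matrix.of fun P k => C (b k) P k) D).det =
      (Matrix.fromBlocks (Matrix.of fun r k => ∑ v, w v * A v r k) B
          (Matrix.of fun P k => ∑ v, w v * C v P k) D).det := by
  simp only [Matrix.det_apply', Finset.mul_sum]
  rw [Finset.sum_comm]
  refine Finset.sum_congr rfl fun σ _ => ?_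
  simp only [Fintype.prod_sum_type]
  have h : ∀ k : α, ∀ i : α ⊕ κ, ∀ b : α → β, Matrix.fromBlocks
      (Matrix.of fun r k => A (b k) r k) B (Matrix.of fun P k => C (b k) P k) D i (Sum.inl k) =
      Sum.elim (fun r => A (b k) r k) (fun P => C (b k) P k) i := by
    rintro k (r | P) b <;> rfl
  have h' : ∀ k : α, ∀ i : α ⊕ κ, Matrix.fromBlocks (Matrix.of fun r k => ∑ v, w v * A v r k) B
      (Matrix.of fun P k => ∑ v, w v * C v P k) D i (Sum.inl k) =
      ∑ v, w v * Sum.elim (fun r => A v r k) (fun P => C v P k) i := by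
    rintro k (r | P) <;> rfl
  have h'' : ∀ k : κ, ∀ i : α ⊕ κ, ∀ (A : Matrix α α ℂ) (C : Matrix κ α ℂ),
      Matrix.fromBlocks A B C D i (Sum.inr k) = Sum.elim (fun r => B r k) (fun P => D P k) i := by
    rintro k (r | P) A C <;> rfl
  simp only [h, h', h'', Finset.prod_univ_sum, Fintype.piFinset_univ, Finset.sum_mul,
    Finset.mul_sum, Finset.prod_mul_distrib]
  exact Finset.sum_congr rfl fun b _ => by ring

section

variable {p : ℝ} {γ : ℝ → ℂ} {m : ℕ} {n : Fin m → ℕ} {S : Finset (Fin m)} {a : Fin m → ℤ}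
  {L A : ℤ}

open scoped Classical in
lemma phiStar_add_one (n n' t t' : ℕ) (x x' : ℤ) :
    phiStar p γ (n, t + 1) (n', t' + 1) x x' = phiStar p γ (n, t) (n', t') x x' := by
  have : Prec (n, t + 1) (n', t' + 1) ↔ Prec (n, t) (n', t') := by
    simp [Prec]
  unfold phiStar
  simp only [Nat.cast_add, Nat.cast_one, add_sub_add_right_eq_sub]
  exact if_congr this rfl rfl

/-- The backward equation. -/
lemma IsContour.det_blockKernel_add_one (hγ : IsContour p γ) (hp : p ≠ 0) (y : ℕ → ℤ)
    (t : Fin m → ℕ) (c : ℤ) (N : ℕ) :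
    (blockKernel p γ y n (fun i => t i + 1) S a L A (c + 1) N).det =
      ∑ b : Finset.Icc 1 N → Bool, (∏ k, (attemptWeight p (b k) : ℂ)) *
        (blockKernel p γ (stepPos (extendAttempts b) y) n t S a L A c N).det := by
  have hstep : ∀ (b : Finset.Icc 1 N → Bool) (k : Finset.Icc 1 N),
      stepPos (extendAttempts b) y k = stepPos (fun _ => b k) y k := fun b k => by
    simp [stepPos, extendAttempts]
  have h0 := sum_prod_mul_det (α := Finset.Icc 1 N) (fun b => (attemptWeight p b : ℂ))
    (fun b => pairMatrix p c (stepPos (fun _ => b) y) N) (windowDual p n t S a L A c N)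
    (fun b => windowPsi p γ (stepPos (fun _ => b) y) n t S a L A N)
    (1 + windowPhi p γ n t S a L A)
  have h1 : ∀ b : Finset.Icc 1 N → Bool,
      blockKernel p γ (stepPos (extendAttempts b) y) n t S a L A c N =
      Matrix.fromBlocks (Matrix.of fun r k => pairMatrix p c (stepPos (fun _ => b k) y) N r k)
        (windowDual p n t S a L A c N)
        (Matrix.of fun P k => windowPsi p γ (stepPos (fun _ => b k) y) n t S a L A N P k)
        (1 + windowPhi p γ n t S a L A) := by
    intro b
    rw [blockKernel]
    congr 1
    · ext r k
      simp only [pairMatrix, pairCoeff, Matrix.of_apply, hstep]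
    · ext P k
      simp only [windowPsi, Psi, Matrix.of_apply, hstep]
  simp only [h1]
  rw [h0]
  have hA : (Matrix.of fun r k => ∑ b : Bool, (attemptWeight p b : ℂ) *
      pairMatrix p c (stepPos (fun _ => b) y) N r k) =
      pairMatrix p (c + 1) y N * blockingMatrix p y N := by
    ext r k
    rw [Matrix.mul_apply]
    refine (sum_mul_blockingMatrix (G₀ := fun k Y => pairCoeff p c (fun _ => Y) r k)
      (G₁ := fun k Y => pairCoeff p (c + 1) (fun _ => Y) r k) ?_ ?_ y k).symm
    · intro k Y
      simp only [pairCoeff]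
      rw [show c + 1 + (k : ℤ) = c + k + 1 by ring, ratCoeff_add_one_left',
        show Y + 1 + (k : ℤ) = Y + k + 1 by ring]
    · intro k Y
      simp only [pairCoeff]
      rw [show c + 1 + ((k + 1 : ℕ) : ℤ) = c + (k + 1 : ℕ) + 1 by ring, ratCoeff_add_one_left]
      push_cast
      rw [show c + 1 + (k : ℤ) = c + (k + 1) by ring, show Y + 1 + (k : ℤ) = Y + (k + 1) by ring,
        show (k : ℤ) + 1 - r - 1 = k - r by ring]
      ring
  have hC : (Matrix.of fun P k => ∑ b : Bool, (attemptWeight p b : ℂ) *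
      windowPsi p γ (stepPos (fun _ => b) y) n t S a L A N P k) =
      windowPsi p γ y n (fun i => t i + 1) S a L A N * blockingMatrix p y N := by
    ext P k
    rw [Matrix.mul_apply]
    refine (sum_mul_blockingMatrix
      (G₀ := fun k Y => chiOn S a (P.1, (P.2 : ℤ)) * Psi p γ (fun _ => Y) (n P.1) (t P.1) k P.2)
      (G₁ := fun k Y => chiOn S a (P.1, (P.2 : ℤ)) *
        Psi p γ (fun _ => Y) (n P.1) (t P.1 + 1) k P.2) ?_ ?_ y k).symm
    · intro k Y
      simp only [hγ.Psi_eq hp]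
      push_cast
      rw [show (t P.1 : ℤ) + 1 - n P.1 + k = t P.1 - n P.1 + k + 1 by ring,
        hγ.ratInt_add_one_left' hp,
        show Y + 1 - (P.2 : ℤ) - 1 - n P.1 + k = Y - (P.2 : ℤ) - 1 - n P.1 + k + 1 by ring]
      ring
    · intro k Y
      simp only [hγ.Psi_eq hp]
      push_cast
      rw [show (t P.1 : ℤ) + 1 - n P.1 + (k + 1) = t P.1 - n P.1 + (k + 1) + 1 by ring,
        hγ.ratInt_add_one_left hp,
        show Y + 1 - (P.2 : ℤ) - 1 - n P.1 + k = Y - (P.2 : ℤ) - 1 - n P.1 + (k + 1) by ring,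
        show (t P.1 : ℤ) + 1 - n P.1 + k = t P.1 - n P.1 + (k + 1) by ring,
        show (n P.1 : ℤ) - (k + 1) + 1 = n P.1 - k by ring]
      ring
  -- The polynomials involve only `c - t`; raising `c` along with the times leaves them unchanged.
  have hB : windowDual p n (fun i => t i + 1) S a L A (c + 1) N =
      windowDual p n t S a L A c N := by
    ext r Q
    simp only [windowDual, dualPoly, Matrix.of_apply]
    push_cast
    rw [add_sub_add_right_eq_sub]
  have hD : windowPhi p γ n (fun i => t i + 1) S a L A = windowPhi p γ n t S a L A := by
    ext P Q
    simp only [windowPhi, Matrix.of_apply, phiStar_add_one]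
  have hmul : Matrix.fromBlocks (pairMatrix p (c + 1) y N * blockingMatrix p y N)
      (windowDual p n t S a L A c N)
      (windowPsi p γ y n (fun i => t i + 1) S a L A N * blockingMatrix p y N)
      (1 + windowPhi p γ n t S a L A) =
      blockKernel p γ y n (fun i => t i + 1) S a L A (c + 1) N *
        Matrix.fromBlocks (blockingMatrix p y N) 0 0 1 := by
    rw [blockKernel, Matrix.fromBlocks_multiply, hB, hD]
    simp
  rw [hA, hC, hmul, Matrix.det_mul, Matrix.det_fromBlocks_zero₂₁, det_blockingMatrix]
  simp

end

/-! ### The Markov property -/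

/-- The positions at time `s`, as a function of the attempts and the initial positions. -/
def traj (b : ℕ → ℕ → Bool) (y : ℕ → ℤ) : ℕ → ℕ → ℤ
  | 0 => y
  | s + 1 => stepPos (fun j => b j s) (traj b y s)

lemma traj_add_one (b : ℕ → ℕ → Bool) (y : ℕ → ℤ) (s : ℕ) :
    traj b y (s + 1) = traj (fun j s => b j (s + 1)) (stepPos (fun j => b j 0) y) s := by
  induction s with
  | zero => rfl
  | succ s ih => rw [traj, ih]; rfl

lemma stepPos_congr {N : ℕ} {b b' : ℕ → Bool} {y y' : ℕ → ℤ}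
    (hb : ∀ j ∈ Finset.Icc 1 N, b j = b' j) (hy : ∀ j ∈ Finset.Icc 1 N, y j = y' j) :
    ∀ j ∈ Finset.Icc 1 N, stepPos b y j = stepPos b' y' j := by
  intro j hj
  unfold stepPos
  rw [hb j hj, hy j hj]
  rcases eq_or_ne j 1 with rfl | h
  · simp
  · rw [hy (j - 1) (by rw [Finset.mem_Icc] at hj ⊢; omega)]

lemma traj_congr {N : ℕ} {b b' : ℕ → ℕ → Bool} {y y' : ℕ → ℤ} {s : ℕ}
    (hb : ∀ j ∈ Finset.Icc 1 N, ∀ s' < s, b j s' = b' j s')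
    (hy : ∀ j ∈ Finset.Icc 1 N, y j = y' j) :
    ∀ j ∈ Finset.Icc 1 N, traj b y s j = traj b' y' s j := by
  induction s with
  | zero => exact hy
  | succ s ih =>
    exact stepPos_congr (fun j hj => hb j hj s (Nat.lt_succ_self s))
      (ih fun j hj s' hs' => hb j hj s' (by omega))

/-- The attempts of the particles `1, …, M` are independent and succeed with probability `p`. -/
structure IsAttempts {Ω : Type*} [MeasurableSpace Ω] (μ : Measure Ω) (p : ℝ) (M : ℕ)
    (ξ : ℕ → ℕ → Ω → Bool) : Prop where
  measurable : ∀ j ∈ Finset.Icc 1 M, ∀ s, Measurable (ξ j s)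
  indep : iIndepFun (fun i : Finset.Icc 1 M × ℕ => ξ i.1 i.2) μ
  prob : ∀ j ∈ Finset.Icc 1 M, ∀ s, μ.real {ω | ξ j s ω = true} = p

namespace IsAttempts

variable {Ω : Type*} [MeasurableSpace Ω] {μ : Measure Ω} {p : ℝ} {M : ℕ} {ξ : ℕ → ℕ → Ω → Bool}

lemma shift (h : IsAttempts μ p M ξ) : IsAttempts μ p M fun j s => ξ j (s + 1) where
  measurable j hj s := h.measurable j hj (s + 1)
  indep := h.indep.precomp (g := fun i : Finset.Icc 1 M × ℕ => (i.1, i.2 + 1)) fun i i' hi => by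
    simp only [Prod.mk.injEq, add_left_inj] at hi
    exact Prod.ext hi.1 hi.2
  prob j hj s := h.prob j hj (s + 1)

lemma mono (h : IsAttempts μ p M ξ) {N : ℕ} (hN : N ≤ M) : IsAttempts μ p N ξ where
  measurable j hj s := h.measurable j (Finset.Icc_subset_Icc_right hN hj) s
  indep := h.indep.precomp
    (g := fun i : Finset.Icc 1 N × ℕ => (⟨i.1, Finset.Icc_subset_Icc_right hN i.1.2⟩, i.2))
    fun i i' hi => by
      simp only [Prod.mk.injEq, Subtype.mk.injEq] at hi
      exact Prod.ext (Subtype.ext hi.1) hi.2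
  prob j hj s := h.prob j (Finset.Icc_subset_Icc_right hN hj) s

lemma prob_eq [IsProbabilityMeasure μ] (h : IsAttempts μ p M ξ) {j : ℕ}
    (hj : j ∈ Finset.Icc 1 M) (s : ℕ) (b : Bool) :
    μ.real {ω | ξ j s ω = b} = attemptWeight p b := by
  cases b with
  | true => simpa [attemptWeight] using h.prob j hj s
  | false =>
    have h1 : {ω | ξ j s ω = false} = {ω | ξ j s ω = true}ᶜ := by ext ω; simp
    have h2 : MeasurableSet {ω | ξ j s ω = true} :=
      h.measurable j hj s (measurableSet_singleton true)
    rw [h1, measureReal_compl h2, h.prob j hj s]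
    simp [attemptWeight]

lemma prob_first [IsProbabilityMeasure μ] (h : IsAttempts μ p M ξ) (b : Finset.Icc 1 M → Bool) :
    μ.real {ω | ∀ k : Finset.Icc 1 M, ξ k 0 ω = b k} = ∏ k, attemptWeight p (b k) := by
  have h1 := h.indep.precomp (g := fun k : Finset.Icc 1 M => (k, 0)) fun k k' hk => by
    simpa using hk
  have h2 := h1.measure_inter_preimage_eq_mul Finset.univ (sets := fun k => {b k})
    fun k _ => measurableSet_singleton _
  have h3 : {ω | ∀ k : Finset.Icc 1 M, ξ k 0 ω = b k} =
      ⋂ k ∈ (Finset.univ : Finset (Finset.Icc 1 M)), ξ k 0 ⁻¹' {b k} := by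
    ext ω; simp
  rw [h3, Measure.real, h2, ENNReal.toReal_prod]
  exact Finset.prod_congr rfl fun k _ => h.prob_eq k.2 0 (b k)

/-- The Markov property at time `1`. -/
lemma prob_add_one [IsProbabilityMeasure μ] (h : IsAttempts μ p M ξ) {ι : Type*} (S : Finset ι)
    (n t : ι → ℕ) (a : ι → ℤ) (hn : ∀ i ∈ S, n i ∈ Finset.Icc 1 M) (y : ℕ → ℤ) :
    μ.real {ω | ∀ i ∈ S, a i ≤ traj (fun j s => ξ j s ω) y (t i + 1) (n i)} =
      ∑ b : Finset.Icc 1 M → Bool, (∏ k, attemptWeight p (b k)) *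
        μ.real {ω | ∀ i ∈ S, a i ≤
          traj (fun j s => ξ j (s + 1) ω) (stepPos (extendAttempts b) y) (t i) (n i)} := by
  -- After the first step only the attempts at times `1, …, T - 1` matter. Finitely many Boolean
  -- variables make all events measurable and suffice for the independence argument.
  set T := S.sup t + 1 with hT
  set S₀ : Finset (Finset.Icc 1 M × ℕ) := Finset.univ ×ˢ {0} with hS₀
  set S₁ : Finset (Finset.Icc 1 M × ℕ) := Finset.univ ×ˢ Finset.Ico 1 T with hS₁
  have hdisj : Disjoint S₀ S₁ := by
    rw [Finset.disjoint_left]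
    rintro ⟨k, s⟩ h0 h1
    simp [hS₀, hS₁] at h0 h1
    omega
  have hmeas : ∀ i : Finset.Icc 1 M × ℕ, Measurable (ξ i.1 i.2) := fun i =>
    h.measurable i.1 i.1.2 i.2
  have hind := h.indep.indepFun_finset S₀ S₁ hdisj hmeas
  set Z₀ : Ω → S₀ → Bool := fun ω i => ξ i.1.1 i.1.2 ω with hZ₀
  set Z₁ : Ω → S₁ → Bool := fun ω i => ξ i.1.1 i.1.2 ω with hZ₁
  have hZ₀m : Measurable Z₀ := measurable_pi_lambda _ fun i => hmeas i.1
  have hZ₁m : Measurable Z₁ := measurable_pi_lambda _ fun i => hmeas i.1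
  set F : (Finset.Icc 1 M → Bool) → Set Ω := fun b => {ω | ∀ k : Finset.Icc 1 M, ξ k 0 ω = b k}
    with hF
  set G : (Finset.Icc 1 M → Bool) → Set Ω := fun b => {ω | ∀ i ∈ S, a i ≤
    traj (fun j s => ξ j (s + 1) ω) (stepPos (extendAttempts b) y) (t i) (n i)} with hG
  have hF' : ∀ b, ∃ B : Set (S₀ → Bool), MeasurableSet B ∧ F b = Z₀ ⁻¹' B := by
    intro b
    refine ⟨{z | ∀ i, z i = b i.1.1}, (Set.toFinite _).measurableSet, ?_⟩
    ext ω
    simp only [hF, hZ₀, Set.mem_ofPred_eq, Set.mem_preimage]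
    constructor
    · rintro hω ⟨⟨k, s⟩, hi⟩
      obtain rfl : 0 = s := by simpa [hS₀] using hi
      exact hω k
    · intro hω k
      exact hω ⟨(k, 0), by simp [hS₀]⟩
  have hG' : ∀ b, ∃ B : Set (S₁ → Bool), MeasurableSet B ∧ G b = Z₁ ⁻¹' B := by
    intro b
    refine ⟨{z | ∀ i ∈ S, a i ≤ traj (fun j s =>
      if hj : ∃ hj : j ∈ Finset.Icc 1 M, ((⟨j, hj⟩, s + 1) : Finset.Icc 1 M × ℕ) ∈ S₁ then
        z ⟨(⟨j, hj.1⟩, s + 1), hj.2⟩ else false) (stepPos (extendAttempts b) y) (t i) (n i)},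
      (Set.toFinite _).measurableSet, ?_⟩
    ext ω
    simp only [hG, Set.mem_ofPred_eq, Set.mem_preimage]
    refine forall₂_congr fun i hi => ?_
    rw [traj_congr (N := M) (fun j hj s hs => ?_) (fun _ _ => rfl) (n i) (hn i hi)]
    rw [dif_pos ⟨hj, by
      have := Finset.le_sup (f := t) hi
      simp only [hS₁, Finset.mem_product, Finset.mem_univ, true_and, Finset.mem_Ico]
      omega⟩]
  have hmul : ∀ b, μ.real (F b ∩ G b) = μ.real (F b) * μ.real (G b) := by
    intro b
    obtain ⟨B₀, hB₀, h₀⟩ := hF' b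
    obtain ⟨B₁, hB₁, h₁⟩ := hG' b
    rw [h₀, h₁, Measure.real, hind.measure_inter_preimage_eq_mul B₀ B₁ hB₀ hB₁, ENNReal.toReal_mul]
    rfl
  have hunion : {ω | ∀ i ∈ S, a i ≤ traj (fun j s => ξ j s ω) y (t i + 1) (n i)} =
      ⋃ b, F b ∩ G b := by
    have key : ∀ b ω, ω ∈ F b → (ω ∈ G b ↔
        ∀ i ∈ S, a i ≤ traj (fun j s => ξ j s ω) y (t i + 1) (n i)) := by
      intro b ω hω
      simp only [hG, Set.mem_ofPred_eq]
      refine forall₂_congr fun i hi => ?_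
      rw [traj_add_one, traj_congr (N := M) (fun _ _ _ _ => rfl) ?_ (n i) (hn i hi)]
      refine stepPos_congr (fun j hj => ?_) fun _ _ => rfl
      rw [extendAttempts, dif_pos hj]
      exact (hω ⟨j, hj⟩).symm
    ext ω
    simp only [Set.mem_ofPred_eq, Set.mem_iUnion, Set.mem_inter_iff]
    constructor
    · intro hω
      have : ω ∈ F fun k => ξ k 0 ω := fun _ => rfl
      exact ⟨_, this, (key _ ω this).2 hω⟩
    · rintro ⟨b, hb, hb'⟩
      exact (key b ω hb).1 hb'
  have hdisjF : Pairwise (Function.onFun Disjoint fun b => F b ∩ G b) := by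
    intro b b' hbb
    rw [Function.onFun, Set.disjoint_left]
    rintro ω ⟨h1, -⟩ ⟨h2, -⟩
    exact hbb (funext fun k => (h1 k).symm.trans (h2 k))
  have hmeasFG : ∀ b, MeasurableSet (F b ∩ G b) := by
    intro b
    obtain ⟨B₀, hB₀, h₀⟩ := hF' b
    obtain ⟨B₁, hB₁, h₁⟩ := hG' b
    rw [h₀, h₁]
    exact (hZ₀m hB₀).inter (hZ₁m hB₁)
  rw [hunion, Measure.real, measure_iUnion hdisjF hmeasFG, tsum_fintype,
    ENNReal.toReal_sum fun b _ => measure_ne_top _ _]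
  refine Finset.sum_congr rfl fun b _ => ?_
  change μ.real _ = _
  rw [hmul, h.prob_first b]

end IsAttempts

lemma IsParallelTASEP.eq_traj {Ω : Type*} [MeasurableSpace Ω] {μ : Measure Ω} {p : ℝ} {N : ℕ∞}
    {y : ℕ → ℤ} {ξ : ℕ → ℕ → Ω → Bool} {x : ℕ → ℕ → Ω → ℤ} (hx : IsParallelTASEP μ p N y ξ x)
    (ω : Ω) (s j : ℕ) (hj : IsLabel N j) : x j s ω = traj (fun j s => ξ j s ω) y s j := by
  induction s generalizing j with
  | zero => exact hx.init j ω hj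
  | succ s ih =>
    rw [hx.step j s ω hj, traj, stepPos, ih j hj]
    rcases eq_or_ne j 1 with rfl | h
    · simp
    · have := hj.1
      rw [ih (j - 1) ⟨by omega, le_trans (by exact_mod_cast Nat.sub_le j 1) hj.2⟩]

/-! ### The joint distribution as a finite determinant -/

/-- At time `0`, `dualPoly` evaluated at `y n` is column `n` of `pairCoeff`; invertibility then
forces a unit vector. -/
lemma IsDual.apply_initial {p : ℝ} {c : ℤ} {y : ℕ → ℤ} {n : ℕ} {Φ : ℕ → ℤ → ℂ}
    (hΦ : IsDual p c y n 0 Φ) (hn : 1 ≤ n) {k : ℕ} (hk : k ∈ Finset.Icc 1 n) :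
    Φ k (y n) = if k = n then 1 else 0 := by
  have hnn : n ∈ Finset.Icc 1 n := Finset.mem_Icc.2 ⟨hn, le_rfl⟩
  set v : Finset.Icc 1 n → ℂ := fun k => Φ k (y n) - if (k : ℕ) = n then 1 else 0 with hv
  have h : (pairMatrix p c y n).mulVec v = 0 := by
    ext r
    simp only [Matrix.mulVec, dotProduct, hv, mul_sub, Finset.sum_sub_distrib, pairMatrix,
      Matrix.of_apply, Pi.zero_apply]
    rw [Finset.sum_coe_sort (Finset.Icc 1 n) fun k => pairCoeff p c y r k * Φ k (y n),
      Finset.sum_coe_sort (Finset.Icc 1 n) fun k => pairCoeff p c y r k * if k = n then 1 else 0,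
      hΦ r r.2]
    simp [dualPoly, pairCoeff, hn]
  have h0 := Matrix.eq_zero_of_mulVec_eq_zero (by rw [det_pairMatrix]; exact one_ne_zero) h
  exact sub_eq_zero.1 (congrFun h0 ⟨k, hk⟩)

section

variable {p : ℝ} {γ : ℝ → ℂ} {y : ℕ → ℤ} {m : ℕ} {n t : Fin m → ℕ} {a : Fin m → ℤ} {L A : ℤ}
  {Φ : Fin m → ℕ → ℤ → ℂ}

lemma windowKernel_congr {t' : Fin m → ℕ} {S : Finset (Fin m)} (h : ∀ i ∈ S, t i = t' i) :
    windowKernel p γ y n t S a L A Φ = windowKernel p γ y n t' S a L A Φ := by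
  ext P Q
  simp only [windowKernel, Matrix.of_apply, extKernel]
  by_cases hP : P.1 ∈ S
  · by_cases hQ : Q.1 ∈ S
    · rw [h _ hP, h _ hQ]
    · simp [chiOn_of_notMem a (P := (Q.1, (Q.2 : ℤ))) hQ]
  · simp [chiOn_of_notMem a (P := (P.1, (P.2 : ℤ))) hP]

/-- A level at time `0` whose particle starts to the right of the cut-off can be dropped. -/
lemma IsContour.det_windowKernel_insert (hγ : IsContour p γ) (hp : p ≠ 0) {M : ℕ}
    (hy : StrictDecr M y) {q : Fin m} {S : Finset (Fin m)} (hq : q ∉ S) (hqM : n q ≤ M)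
    (hS : ∀ i ∈ S, Prec (n i, t i) (n q, t q)) (haq : a q ≤ y (n q)) :
    (1 - windowKernel p γ y n t (insert q S) a L A Φ).det =
      (1 - windowKernel p γ y n t S a L A Φ).det := by
  set X := windowKernel p γ y n t (insert q S) a L A Φ with hX
  set E : Matrix (Window m L A) (Window m L A) ℂ :=
    Matrix.diagonal fun P => chiOn S a (P.1, (P.2 : ℤ)) with hE
  have hrow : ∀ P Q : Window m L A, P.1 = q → X P Q = 0 := by
    intro P Q hP
    rw [hX, windowKernel, Matrix.of_apply]
    by_cases hlt : (P.2 : ℤ) < a q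
    · by_cases hQ : Q.1 ∈ insert q S
      · rw [hγ.extKernel_eq_zero_of_not_prec hp hy (P := (P.1, (P.2 : ℤ))), mul_zero, zero_mul]
        · rwa [hP]
        · rcases Finset.mem_insert.1 hQ with h | h
          · rw [h, hP]
          · rw [hP]
            exact (hS _ h).1
        · rcases Finset.mem_insert.1 hQ with h | h
          · rw [h, hP]
            exact fun h' => h'.2.2 rfl
          · rw [hP]
            exact (hS _ h).not_symm
        · rw [hP]
          exact hlt.trans_le haq
      · rw [chiOn_of_notMem a (P := (Q.1, (Q.2 : ℤ))) hQ, mul_zero]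
    · rw [chiOn, if_neg (by rw [hP]; exact fun h => hlt h.2), zero_mul, zero_mul]
  have hchi : ∀ P : Window m L A, P.1 ≠ q →
      chiOn (insert q S) a (P.1, (P.2 : ℤ)) = chiOn S a (P.1, (P.2 : ℤ)) := by
    intro P hP
    simp [chiOn, hP]
  have hidem : ∀ P : Window m L A, chiOn S a (P.1, (P.2 : ℤ)) * chiOn S a (P.1, (P.2 : ℤ)) =
      chiOn S a (P.1, (P.2 : ℤ)) := by
    intro P
    unfold chiOn
    split_ifs <;> simp
  have h1 : E * X = X := by
    ext P Q
    rw [hE, Matrix.diagonal_mul]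
    by_cases hP : P.1 = q
    · rw [hrow P Q hP, mul_zero]
    · rw [hX, windowKernel, Matrix.of_apply, hchi P hP, mul_assoc, ← mul_assoc, hidem]
  have h2 : X * E = windowKernel p γ y n t S a L A Φ := by
    ext P Q
    rw [hE, Matrix.mul_diagonal]
    by_cases hP : P.1 = q
    · rw [hrow P Q hP, zero_mul, windowKernel, Matrix.of_apply,
        chiOn_of_notMem a (P := (P.1, (P.2 : ℤ))) (by rwa [hP]), zero_mul, zero_mul]
    · simp only [hX, windowKernel, Matrix.of_apply, hchi P hP]
      by_cases hQ : Q.1 = q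
      · simp [chiOn_of_notMem (S := S) a (P := (Q.1, (Q.2 : ℤ))) (by rwa [hQ])]
      · rw [hchi Q hQ, mul_assoc, hidem]
  -- The rows of level `q` vanish, so `E * X = X`. Exchanging the factors removes the columns of
  -- that level as well.
  rw [← h1, Matrix.det_one_sub_mul_comm, h2]

/-- If the particle of a level at time `0` starts to the left of the cut-off, then the
determinant vanishes. -/
lemma IsContour.det_windowKernel_eq_zero (hγ : IsContour p γ) (hp : p ≠ 0) {c : ℤ} {q : Fin m}
    {S : Finset (Fin m)} (hqn : 1 ≤ n q) (ht : t q = 0)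
    (hS : ∀ i ∈ S, Prec (n i, t i) (n q, t q)) (hΦ : IsDual p c y (n q) (t q) (Φ q))
    (hL : L ≤ y (n q)) (hA : a q ≤ A) (haq : y (n q) < a q) :
    (1 - windowKernel p γ y n t (insert q S) a L A Φ).det = 0 := by
  -- The point occupied by particle `n q` at time `0`. There the sum over `k` reduces to `Psi` with
  -- `k = n q`, which equals `phiStar` on the other levels in `S` and a point mass on level `q`.
  set Q : Window m L A := (q, ⟨y (n q), Finset.mem_Ico.2 ⟨hL, by omega⟩⟩) with hQ
  refine Matrix.det_eq_zero_of_column_eq_zero Q fun P => ?_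
  rw [ht] at hΦ
  have hker : ∑ k ∈ Finset.Icc 1 (n q), Psi p γ y (n P.1) (t P.1) k P.2 * Φ q k (y (n q)) =
      Psi p γ y (n P.1) (t P.1) (n q) P.2 := by
    rw [Finset.sum_congr rfl fun k hk => by rw [hΦ.apply_initial hqn hk]]
    simp [hqn]
  have hQchi : chiOn (insert q S) a (Q.1, (Q.2 : ℤ)) = 1 := by
    simp [chiOn, hQ, haq]
  rw [Matrix.sub_apply, windowKernel, Matrix.of_apply, hQchi, mul_one, extKernel]
  simp only [hQ]
  rw [hker]
  by_cases hPq : P.1 = q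
  · rw [hPq, phiStar, if_neg (fun h => h.2.2 rfl), neg_zero, zero_add, ht, hγ.Psi_eq hp]
    simp only [Nat.cast_zero, zero_sub, neg_add_cancel, sub_self, sub_add_cancel]
    rw [hγ.ratInt_mid]
    by_cases hx : (P.2 : ℤ) = y (n q)
    · have : P = Q := Prod.ext hPq (Subtype.ext hx)
      rw [if_pos (by omega), this, Matrix.one_apply_eq, hQ]
      simp [chiOn, haq]
    · have : P ≠ Q := fun h => hx (by rw [h])
      rw [if_neg (by omega), Matrix.one_apply_ne this]
      simp
  · have : P ≠ Q := fun h => hPq (by rw [h])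
    rw [Matrix.one_apply_ne this]
    by_cases hPS : P.1 ∈ S
    · rw [hγ.phiStar_eq hp (hS _ hPS), hγ.Psi_eq hp]
      simp only [ht]
      rw [show (t P.1 : ℤ) - (0 : ℕ) + n q - n P.1 = t P.1 - n P.1 + n q by push_cast; ring,
        show y (n q) - (P.2 : ℤ) - 1 + n q - n P.1 = y (n q) - P.2 - 1 - n P.1 + n q by ring]
      simp
    · rw [chiOn_of_notMem a (P := (P.1, (P.2 : ℤ))) (by simp [hPq, hPS])]
      simp

end

/-- Induction on the set of levels, removing the last one, and inside it on the time of that last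
level. A time step changes `y`, the attempts, `c` and `Φ`, so all of them stay quantified. -/
theorem IsContour.det_windowKernel_eq_prob {Ω : Type*} [MeasurableSpace Ω] {μ : Measure Ω}
    [IsProbabilityMeasure μ] {p : ℝ} {γ : ℝ → ℂ} (hγ : IsContour p γ) (hp : p ≠ 0) {M m : ℕ}
    {n : Fin m → ℕ} (hn : ∀ i, n i ∈ Finset.Icc 1 M) {a : Fin m → ℤ} {L A : ℤ}
    (hA : ∀ i, a i ≤ A) (S : Finset (Fin m)) :
    ∀ (t : Fin m → ℕ) (y : ℕ → ℤ) (ξ : ℕ → ℕ → Ω → Bool) (c : ℤ) (Φ : Fin m → ℕ → ℤ → ℂ),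
      (∀ i ∈ S, ∀ j ∈ S, i < j → Prec (n i, t i) (n j, t j)) → StrictDecr M y →
      IsAttempts μ p M ξ → (∀ i ∈ S, L ≤ y (n i)) →
      (∀ i ∈ S, IsDual p c y (n i) (t i) (Φ i)) →
      (1 - windowKernel p γ y n t S a L A Φ).det =
        (μ.real {ω | ∀ i ∈ S, a i ≤ traj (fun j s => ξ j s ω) y (t i) (n i)} : ℂ) := by
  induction S using Finset.induction_on_max with
  | empty =>
    intro t y ξ c Φ _ _ _ _ _
    have : windowKernel p γ y n t ∅ a L A Φ = 0 := by
      ext P Q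
      simp [windowKernel, chiOn]
    rw [this]
    simp
  | insert q S hmax ihS =>
    intro t
    obtain ⟨τ, hτ⟩ : ∃ τ, t q = τ := ⟨_, rfl⟩
    have hqS : q ∉ S := fun h => lt_irrefl _ (hmax q h)
    induction τ generalizing t with
    | zero =>
      intro y ξ c Φ hS hy hξ hL hΦ
      have hSq : ∀ i ∈ S, Prec (n i, t i) (n q, t q) := fun i hi =>
        hS i (Finset.mem_insert_of_mem hi) q (Finset.mem_insert_self _ _) (hmax i hi)
      have hnq := Finset.mem_Icc.1 (hn q)
      rcases le_or_gt (a q) (y (n q)) with haq | haq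
      · rw [hγ.det_windowKernel_insert hp hy hqS hnq.2 hSq haq,
          ihS t y ξ c Φ (fun i hi j hj => hS i (Finset.mem_insert_of_mem hi) j
            (Finset.mem_insert_of_mem hj)) hy hξ (fun i hi => hL i (Finset.mem_insert_of_mem hi))
            fun i hi => hΦ i (Finset.mem_insert_of_mem hi)]
        congr 2
        ext ω
        simp only [Finset.forall_mem_insert, Set.mem_ofPred_eq, hτ]
        exact (and_iff_right haq).symm
      · rw [hγ.det_windowKernel_eq_zero hp hnq.1 hτ hSq (hΦ q (Finset.mem_insert_self _ _))
          (hL q (Finset.mem_insert_self _ _)) (hA q) haq]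
        have : {ω | ∀ i ∈ insert q S, a i ≤ traj (fun j s => ξ j s ω) y (t i) (n i)} = ∅ := by
          ext ω
          simp only [Finset.forall_mem_insert, Set.mem_ofPred_eq, hτ, Set.mem_empty_iff_false,
            iff_false, not_and]
          intro h
          exact absurd h (not_le.2 haq)
        rw [this]
        simp
    | succ τ ih =>
      intro y ξ c Φ hS hy hξ hL hΦ
      have hSq : ∀ i ∈ insert q S, n i ≤ n q ∧ t q ≤ t i := by
        intro i hi
        rcases Finset.mem_insert.1 hi with rfl | h
        · exact ⟨le_rfl, le_rfl⟩
        · have := hS i hi q (Finset.mem_insert_self _ _) (hmax i h)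
          exact ⟨this.1, this.2.1⟩
      -- The subtraction is genuine on `insert q S`, where `t i ≥ t q > 0`; other levels do not
      -- enter the kernel.
      set t' : Fin m → ℕ := fun i => t i - 1 with ht'
      have htt : ∀ i ∈ insert q S, t i = t' i + 1 := fun i hi => by
        have := (hSq i hi).2
        simp only [ht']
        omega
      have hnq := Finset.mem_Icc.1 (hn q)
      rw [windowKernel_congr htt, ← det_blockKernel (c := c - 1 + 1) (N := n q)
        (fun i hi => (hSq i hi).1) (fun i hi => by
          rw [sub_add_cancel, ← htt i hi]
          exact hΦ i hi), hγ.det_blockKernel_add_one hp]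
      have hprob := (hξ.mono hnq.2).prob_add_one (insert q S) n t' a (fun i hi =>
        Finset.mem_Icc.2 ⟨(Finset.mem_Icc.1 (hn i)).1, (hSq i hi).1⟩) y
      have hev : {ω | ∀ i ∈ insert q S, a i ≤ traj (fun j s => ξ j s ω) y (t i) (n i)} =
          {ω | ∀ i ∈ insert q S, a i ≤ traj (fun j s => ξ j s ω) y (t' i + 1) (n i)} := by
        ext ω
        simp only [Set.mem_ofPred_eq]
        exact forall₂_congr fun i hi => by rw [htt i hi]
      rw [hev, hprob]
      push_cast
      refine Finset.sum_congr rfl fun b _ => ?_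
      congr 1
      -- Biorthogonal functions for the new times and positions may fail to exist; the algebraic
      -- dual family always does.
      have hdual : ∀ i ∈ insert q S, IsDual p (c - 1) (stepPos (extendAttempts b) y) (n i) (t' i)
          (dualFun p (c - 1) (stepPos (extendAttempts b) y) (n i) (t' i)) :=
        fun i _ => isDual_dualFun _ _ _ _ _
      rw [det_blockKernel
        (Φ := fun i => dualFun p (c - 1) (stepPos (extendAttempts b) y) (n i) (t' i))
        (fun i hi => (hSq i hi).1) hdual]
      refine ih t' (by simp only [ht']; omega) _ (fun j s => ξ j (s + 1)) (c - 1) _ ?_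
        (hy.stepPos _) hξ.shift (fun i hi => (hL i hi).trans (le_stepPos _ _ _)) hdual
      intro i hi j hj hij
      have h1 := hS i hi j hj hij
      rw [htt i hi, htt j hj] at h1
      simpa [Prec] using h1

end

/-! ### The joint distribution as a Fredholm determinant -/

theorem theorem5 {Ω : Type*} [MeasurableSpace Ω] (μ : Measure Ω) [IsProbabilityMeasure μ]
    (p : ℝ) (hp₀ : 0 < p) (hp₁ : p < 1)
    -- the system: `N` particles (possibly infinitely many), starting from `y 1 > y 2 > …`
    (N : ℕ∞) (y : ℕ → ℤ) (hy : ∀ i j, IsLabel N i → IsLabel N j → i < j → y j < y i)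
    (ξ : ℕ → ℕ → Ω → Bool) (x : ℕ → ℕ → Ω → ℤ) (hx : IsParallelTASEP μ p N y ξ x)
    -- the space-like path
    (m : ℕ) (n t : Fin m → ℕ) (hn : ∀ i, IsLabel N (n i)) (hS : IsSpaceLike n t)
    (a : Fin m → ℤ)
    -- the contour
    (γ : ℝ → ℂ) (hγ : IsContour p γ) :
    -- the functions `Φ` exist whenever the sums defining them converge, and they are unique
    (∀ i, p < 1 / 2 ∨ n i ≤ t i + 1 → ∃ Φ, IsBiorthogonal p γ y (n i) (t i) Φ) ∧
    (∀ i Φ Φ', IsBiorthogonal p γ y (n i) (t i) Φ → IsBiorthogonal p γ y (n i) (t i) Φ' →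
      ∀ k ∈ Finset.Icc 1 (n i), Φ k = Φ' k) ∧
    -- the joint distribution
    ∀ Φ : Fin m → ℕ → ℤ → ℂ, (∀ i, IsBiorthogonal p γ y (n i) (t i) (Φ i)) →
      HasFredholmDet (fun P Q => chi a P * extKernel p γ y n t Φ P Q * chi a Q)
        (μ.real (⋂ i, {ω | a i ≤ x (n i) (t i) ω}) : ℂ) := by
  refine ⟨fun i h => hγ.exists_isBiorthogonal hp₀ hp₁ y h, fun i Φ Φ' h h' k hk => h.eq h' hk,
    fun Φ hΦ => ?_⟩
  set M := Finset.univ.sup n with hM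
  have hnM : ∀ i, n i ≤ M := fun i => Finset.le_sup (Finset.mem_univ i)
  have hlabel : ∀ j ∈ Finset.Icc 1 M, IsLabel N j := by
    intro j hj
    rw [Finset.mem_Icc] at hj
    obtain ⟨i, -, hi⟩ := (Finset.le_sup_iff (show ⊥ < j from hj.1)).1 hj.2
    exact ⟨hj.1, le_trans (by exact_mod_cast hi) (hn i).2⟩
  have hdecr : StrictDecr M y := fun k hk hkM =>
    hy k (k + 1) (hlabel k (Finset.mem_Icc.2 ⟨hk, hkM.le⟩))
      (hlabel (k + 1) (Finset.mem_Icc.2 ⟨by omega, hkM⟩)) (Nat.lt_succ_self k)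
  have hξ : IsAttempts μ p M ξ := by
    refine ⟨fun j hj s => hx.measurable_attempt j s (hlabel j hj), ?_, fun j hj s => ?_⟩
    · refine hx.indep_attempt.precomp
        (g := fun i : Finset.Icc 1 M × ℕ => (⟨i.1, hlabel i.1 i.1.2⟩, i.2)) fun i i' hi => ?_
      simp only [Prod.mk.injEq, Subtype.mk.injEq] at hi
      exact Prod.ext (Subtype.ext hi.1) hi.2
    · rw [Measure.real, hx.prob_attempt j s (hlabel j hj), ENNReal.toReal_ofReal hp₀.le]
  obtain ⟨L, hL⟩ := (Set.finite_range fun i => y (n i)).bddBelow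
  obtain ⟨A, hA⟩ := (Set.finite_range a).bddAbove
  replace hL : ∀ i, L ≤ y (n i) := fun i => hL ⟨i, rfl⟩
  replace hA : ∀ i, a i ≤ A := fun i => hA ⟨i, rfl⟩
  -- The value `0` of `c` is arbitrary; what matters is that all levels use the same one.
  have hdual : ∀ i, IsDual p 0 y (n i) (t i) (Φ i) := fun i => (hΦ i).isDual hγ hp₀.ne' 0
  have hfred := hγ.hasFredholmDet_extKernel hp₀.ne' hdecr hS hnM hdual hL hA
  have hdet := hγ.det_windowKernel_eq_prob hp₀.ne'
    (fun i => Finset.mem_Icc.2 ⟨(hn i).1, hnM i⟩) hA Finset.univ t y ξ 0 Φ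
    (fun i _ j _ hij => hS.prec hij) hdecr hξ (fun i _ => hL i) fun i _ => hdual i
  have hchi : ∀ P, chiOn Finset.univ a P = chi a P := fun P => by simp [chiOn, chi]
  have hev : (⋂ i, {ω | a i ≤ x (n i) (t i) ω}) =
      {ω | ∀ i ∈ Finset.univ, a i ≤ traj (fun j s => ξ j s ω) y (t i) (n i)} := by
    ext ω
    simp [hx.eq_traj ω _ _ (hn _)]
  rw [hev, ← hdet]
  simpa only [windowKernel, hchi] using hfred
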